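/- **Setting.** Let $H,K$ be real separable Hilbert spaces, $T>0$, and let $C([0,T];H)$ carry the uniform norm $\|x\|_T$; put $x_{\cdot\wedge t}=(x_{s\wedge t})_{s}$ and $\|x\|_t=\|x_{\cdot\wedge t}\|_T$. Let ${\rm U}$ be a nonempty Borel subset of a Polish space, ${\cal P}({\rm U})$ its Borel probability measures with the weak topology. ${\cal P}_2(S)$ denotes the Borel probability measures on a metric space $S$ with finite second moment, with the 2-Wasserstein distance ${\cal W}_2$. Let $(\Omega,{\cal F},\mathbb P)$ be a complete probability space with a $K$-valued cylindrical Brownian motion $B$ with $\mathbb P$-completed filtration $({\cal F}^B_t)$, and let ${\cal G}\subset{\cal F}$ be a $\sigma$-algebra independent of ${\cal F}^B_\infty$ such that every $\mu\in{\cal P}_2(C([0,T];H))$ is the law of some $\xi\in\mathbf S_2({\cal G})$, where $\mathbf S_2({\cal G})$ is the set of continuous, ${\cal B}([0,T])\otimes{\cal G}$-measurable $H$-valued processes $\xi$ with $\mathbb E\|\xi\|_T^2<\infty$. Let ${\cal F}_t={\cal G}\vee{\cal F}^B_t$. **Coefficients.** $A$ generates a $C_0$-semigroup on $H$ with $\|e^{tA}\|\le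 e^{\eta t}$ for some $\eta\in\mathbb R$. The functions $b,\sigma,f$ of $(t,x,\mu,u,\nu)\in[0,T]\times C([0,T];H)\times{\cal P}_2(C([0,T];H))\times{\rm U}\times{\cal P}({\rm U})$, with values in $H$, the Hilbert–Schmidt operators ${\cal L}_2(K;H)$ and $\mathbb R$, and $g\colon C([0,T];H)\times{\cal P}_2(C([0,T];H))\to\mathbb R$ are Borel measurable. There is $L$ with $$|b_t(x,\mu,u,\nu)-b_t(x',\mu',u,\nu)|,\ \|\sigma_t(x,\mu,u,\nu)-\sigma_t(x',\mu',u,\nu)\|_{{\cal L}_2}\le L\big(\|x-x'\|_t+{\cal W}_2(\mu,\mu')\big),\quad |b_t(0,\delta_0,u,\nu)|+\|\sigma_t(0,\delta_0,u,\nu)\|_{{\cal L}_2}\le L .$$ Moreover $f_t(x,\mu,u,\nu)=f_t(x_{\cdot\wedge t},\mu,u,\nu)$, and for a locally bounded $h\colon[0,\infty)\to[0,\infty)$, $|f_t(x,\mu,u,\nu)|\le h({\cal W}_2(\mu,\delta_0))(1+\|x\|_t^2)$ and $|g(x,\mu)|\le h({\cal W}_2(\mu,\delta_0))(1+\|x\|_T^2)$.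 **Pathwise derivatives.** Let $D([0,T];H)$ be the space of càdlàg paths with the Skorokhod distance, and $\mu_{[0,t]}$ the image of $\mu$ under $x\mapsto x_{\cdot\wedge t}$. For $\hat\varphi\colon[0,T]\times{\cal P}_2(D([0,T];H))\to\mathbb R$ with $\hat\varphi(t,\mu)=\hat\varphi(t,\mu_{[0,t]})$: * $\partial_t\hat\varphi(t,\mu)=\lim_{\delta\to0^+}\delta^{-1}(\hat\varphi(t+\delta,\mu_{[0,t]})-\hat\varphi(t,\mu))$ for $t<T$, and $\partial_t\hat\varphi(T,\mu)=\lim_{t\to T^-}\partial_t\hat\varphi(t,\mu)$; * $\partial_\mu\hat\varphi(t,\mu)\colon D([0,T];H)\to H$ is the measurable function such that for every $\hat\xi\in L^2(\Omega;D([0,T];H))$ with law $\mu$, $\hat\varphi(t,\mathbb P_{\hat\xi+Y1_{[t,T]}})=\hat\varphi(t,\mu)+\mathbb E\langle \partial_\mu\hat\varphi(t,\mu)(\hat\xi),Y\rangle+o(|Y|_{L^2})$ as $Y\to0$ in $L^2(\Omega;H)$; * $\partial_x\partial_\mu\hat\varphi(t,\mu)(x)\in{\cal L}(H)$ is the Fréchet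 derivative at $h=0$ of $h\mapsto\partial_\mu\hat\varphi(t,\mu)(x+h1_{[t,T]})$. $\hat\varphi\in\boldsymbol C^{1,2}_b$ means that these derivatives exist everywhere, that $\hat\varphi,\partial_t\hat\varphi,\partial_\mu\hat\varphi,\partial_x\partial_\mu\hat\varphi$ are bounded and continuous, and that $(t,\hat\xi)\mapsto\partial_\mu\hat\varphi(t,\mathbb P_{\hat\xi})(\hat\xi)\in L^2(\Omega;H)$ is continuous. Here $(t_n,\mu_n)\to(t,\mu)$ means $t_n\to t$ and ${\cal W}_2((\mu_n)_{[0,t_n]},\mu_{[0,t]})\to0$; for paths it is required that both $x_n\to x$ and $(x_n)_{\cdot\wedge t_n}\to x_{\cdot\wedge t}$ in the Skorokhod distance (in $L^2$ of it for random paths). $w\in\boldsymbol C_b^{1,2}([0,T]\times{\cal P}_2(C([0,T];H)))$ means that $w(t,\mu)=\hat w(t,\hat\mu)$ for some such $\hat w\in\boldsymbol C^{1,2}_b$, with $\hat\mu$ the image of $\mu$ on $D([0,T];H)$; the derivatives of $w$ at $(t,\mu)$ are those of $\hat w$ at $(t,\hat\mu)$, for any choice of $\hat w$. **Notation.** Let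 $(t,\mu)\in[0,T]\times{\cal P}_2(C([0,T];H))$, $w\in\boldsymbol C_b^{1,2}$, let $\xi\in\mathbf S_2({\cal G})$ have law $\mu$, and set $$F(x,u,\nu)=f_t(x,\mu,u,\nu)+\langle b_t(x,\mu,u,\nu),\partial_\mu w(t,\mu)(x)\rangle_H+\tfrac12{\rm Tr}\big(\sigma_t(x,\mu,u,\nu)\sigma_t^*(x,\mu,u,\nu)\,\partial_x\partial_\mu w(t,\mu)(x)\big).$$ ${\cal M}_t$ (resp. ${\cal M}_{\cal G}$) is the set of ${\cal F}_t$-measurable (resp. ${\cal G}$-measurable) maps $\Omega\to{\rm U}$; $\check{\cal M}$ is the set of Borel maps $C([0,T];H)\times[0,1]\to{\rm U}$; ${\cal M}$ is the set of Borel maps $C([0,T];H)\to{\rm U}$. For a family $(X_u)_u$ of random variables, $\operatorname{ess\,sup}_uX_u$ denotes the least random variable $Z$ (up to null sets) such that, almost surely, $X_u\le Z$ for all $u$ simultaneously. **Proposition.** $F(\xi,\mathfrak a,\mathbb P_{\mathfrak a})$ is integrable for every $\mathfrak a\in{\cal M}_t$, and the following hold. 1. If there is a ${\cal G}$-measurable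 $U_\xi$, uniformly distributed on $[0,1]$ and independent of $\xi$, then $$\sup_{\mathfrak a\in{\cal M}_t}\mathbb E[F(\xi,\mathfrak a,\mathbb P_{\mathfrak a})]=\sup_{\mathfrak a\in{\cal M}_{\cal G}}\mathbb E[F(\xi,\mathfrak a,\mathbb P_{\mathfrak a})]=\sup_{\check{\rm a}\in\check{\cal M}}\mathbb E\big[F\big(\xi,\check{\rm a}(\xi,U_\xi),\mathbb P_{\check{\rm a}(\xi,U_\xi)}\big)\big].$$ 2. If $F$ does not depend on its last argument, $F=F(x,u)$, then $\operatorname{ess\,sup}_{u\in{\rm U}}F(\xi,u)$ exists and is integrable, and $$\sup_{\mathfrak a\in{\cal M}_t}\mathbb E[F(\xi,\mathfrak a)]=\sup_{{\rm a}\in{\cal M}}\mathbb E[F(\xi,{\rm a}(\xi))]=\mathbb E\Big[\operatorname*{ess\,sup}_{u\in{\rm U}}F(\xi,u)\Big].$$ Consequently, if $t<T$ and $\partial_\mu w(t,\mu)(\xi)\in L^2(\Omega;D(A^*))$, the Master Bellman equation at $(t,\mu)$, written with $\xi$, $$\partial_tw(t,\mu)+\mathbb E\langle\xi_t,A^*\partial_\mu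 w(t,\mu)(\xi)\rangle+\sup_{\mathfrak a\in{\cal M}_t}\Big\{\mathbb E\big[f_t(\xi,\mu,\mathfrak a,\mathbb P_{\mathfrak a})+\langle b_t(\xi,\mu,\mathfrak a,\mathbb P_{\mathfrak a}),\partial_\mu w(t,\mu)(\xi)\rangle\big]+\tfrac12\mathbb E\big[{\rm Tr}\big(\sigma_t\sigma_t^*(\xi,\mu,\mathfrak a,\mathbb P_{\mathfrak a})\partial_x\partial_\mu w(t,\mu)(\xi)\big)\big]\Big\}=0,$$ is equivalent to the same equation with the supremum over ${\cal M}_{\cal G}$, and to the one with the supremum over the controls $\check{\rm a}(\xi,U_\xi)$, $\check{\rm a}\in\check{\cal M}$, in case 1; and, in case 2, to the one with the supremum over the controls ${\rm a}(\xi)$, ${\rm a}\in{\cal M}$, and to the one with the supremum term replaced by $\mathbb E[\operatorname{ess\,sup}_{u\in{\rm U}}F(\xi,u)]$. -/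

import Mathlib

open MeasureTheory ProbabilityTheory Set Filter Topology
open scoped ENNReal NNReal RealInnerProductSpace

noncomputable section

namespace MasterBellman

/-! ### Generalities -/

/-- The Borel `σ`-algebra of the topology of a (pseudo-)distance `d`: it is generated by the sets
that contain a `d`-ball around each of their points. -/
@[reducible] def borelOf {X : Type*} (d : X → X → ℝ≥0∞) : MeasurableSpace X :=
  MeasurableSpace.generateFrom {V | ∀ p ∈ V, ∃ ε > 0, ∀ q, d p q < ε → q ∈ V}

/-- Continuity of `f` for the topology of the (pseudo-)distance `d` on the source. -/
def ContinuousFor {X Y : Type*} [PseudoEMetricSpace Y] (d : X → X → ℝ≥0∞) (f : X → Y) : Prop :=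
  ∀ p, ∀ ε > 0, ∃ δ > 0, ∀ q, d p q < δ → edist (f p) (f q) < ε

/-- `Z` is the essential supremum of the family `(X i)` of random variables, in the sense of the
least random variable that, outside one null set, dominates all the members of the family
simultaneously (so `Z` is the smallest measurable majorant of the pathwise supremum, up to null
sets, and `Z = sup_i X i` almost surely if that supremum is finite and measurable). -/
structure IsEssSup {Ω ι : Type*} [MeasurableSpace Ω] (P : Measure Ω) (X : ι → Ω → ℝ)
    (Z : Ω → ℝ) : Prop where
  measurable : Measurable Z
  le_ae : ∀ᵐ ω ∂P, ∀ i, X i ω ≤ Z ω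
  least : ∀ Z' : Ω → ℝ, Measurable Z' → (∀ᵐ ω ∂P, ∀ i, X i ω ≤ Z' ω) → ∀ᵐ ω ∂P, Z ω ≤ Z' ω

/-! ### The Wasserstein space -/

/-- `𝒫₂(S)`: Borel probability measures with finite second moment. -/
structure P2 (S : Type*) [PseudoEMetricSpace S] [MeasurableSpace S] where
  toMeasure : Measure S
  isProb : IsProbabilityMeasure toMeasure
  moment : ∃ x₀ : S, ∫⁻ x, edist x₀ x ^ 2 ∂toMeasure < ∞

/-- The 2-Wasserstein distance (with values in `[0, ∞]`; it is finite on `𝒫₂(S)`). -/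
def wass {S : Type*} [PseudoEMetricSpace S] [MeasurableSpace S] (μ μ' : Measure S) : ℝ≥0∞ :=
  (⨅ π ∈ {π : Measure (S × S) | π.map Prod.fst = μ ∧ π.map Prod.snd = μ'},
    ∫⁻ p, edist p.1 p.2 ^ 2 ∂π) ^ (1 / 2 : ℝ)

/-- The real-valued 2-Wasserstein distance on `𝒫₂(S)`. -/
def P2.W2 {S : Type*} [PseudoEMetricSpace S] [MeasurableSpace S] (μ μ' : P2 S) : ℝ :=
  (wass μ.toMeasure μ'.toMeasure).toReal

/-- The Dirac mass at `x`. -/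
def P2.dirac {S : Type*} [PseudoEMetricSpace S] [MeasurableSpace S] [OpensMeasurableSpace S]
    (x : S) : P2 S where
  toMeasure := Measure.dirac x
  isProb := inferInstance
  moment := ⟨x, by
    rw [lintegral_dirac' x (by fun_prop)]
    simp⟩

/-- `𝒫₂(S)` carries the Borel `σ`-algebra of the Wasserstein distance. -/
instance P2.instMeasurableSpace (S : Type*) [PseudoEMetricSpace S] [MeasurableSpace S] :
    MeasurableSpace (P2 S) :=
  borelOf fun μ μ' => wass μ.toMeasure μ'.toMeasure

/-! ### Hilbert–Schmidt operators and the trace -/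

section Operators

variable (E : Type*) [NormedAddCommGroup E] [InnerProductSpace ℝ E] [CompleteSpace E]

/-- Index set of a chosen orthonormal basis. -/
def OnbIndex : Set E := Classical.choose (exists_hilbertBasis ℝ E)

/-- A chosen orthonormal basis (the notions below do not depend on the choice). -/
def onb : HilbertBasis (OnbIndex E) ℝ E :=
  Classical.choose (Classical.choose_spec (exists_hilbertBasis ℝ E))

variable {E}
variable {K H : Type*} [NormedAddCommGroup K] [InnerProductSpace ℝ K] [CompleteSpace K]
  [NormedAddCommGroup H] [InnerProductSpace ℝ H] [CompleteSpace H]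

/-- The Hilbert–Schmidt norm `(∑ₙ |F eₙ|²)^{1/2}`, with values in `[0, ∞]`. -/
def hsNorm (F : K →L[ℝ] H) : ℝ≥0∞ := (∑' i, ‖F (onb K i)‖ₑ ^ 2) ^ (1 / 2 : ℝ)

variable (K H) in
/-- `ℒ₂(K;H)`: the Hilbert–Schmidt operators. -/
def HS : Type _ := {F : K →L[ℝ] H // hsNorm F < ∞}

/-- `ℒ₂(K;H)` carries the Borel `σ`-algebra of the Hilbert–Schmidt norm. -/
instance HS.instMeasurableSpace : MeasurableSpace (HS K H) :=
  borelOf fun F G => hsNorm (F.1 - G.1)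

/-- The trace of a (trace class) operator. -/
def trace (Q : H →L[ℝ] H) : ℝ := ∑' i, ⟪Q (onb H i), onb H i⟫

end Operators

/-! ### CPath spaces -/

section Paths

variable (T : ℝ) (H : Type*) [NormedAddCommGroup H]

/-- `C([0,T];H)` with the uniform norm. -/
abbrev CPath : Type _ := C(Icc (0 : ℝ) T, H)

instance CPath.instMeasurableSpace : MeasurableSpace (CPath T H) := borel _

instance CPath.instBorelSpace : BorelSpace (CPath T H) := ⟨rfl⟩

/-- `D([0,T];H)`: the càdlàg paths. -/
structure Cadlag where
  toFun : Icc (0 : ℝ) T → H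
  right_cont : ∀ s, ContinuousWithinAt toFun (Ici s) s
  left_lim : ∀ s, ∃ l, Tendsto toFun (𝓝[<] s) (𝓝 l)

variable {T H}

/-- The stopped path `x_{·∧t}`. -/
def CPath.stoppedAt (t : Icc (0 : ℝ) T) (x : CPath T H) : CPath T H :=
  ⟨fun s => x (min s t), by fun_prop⟩

/-- The stopped càdlàg path `x_{·∧t}`. -/
def Cadlag.stoppedAt (t : Icc (0 : ℝ) T) (x : Cadlag T H) : Cadlag T H where
  toFun s := x.toFun (min s t)
  right_cont s := by
    refine ContinuousWithinAt.comp (t := Ici (min s t)) (x.right_cont _)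
      (by fun_prop) ?_
    intro r hr
    exact min_le_min_right t hr
  left_lim s := by
    rcases le_or_gt s t with h | h
    · obtain ⟨l, hl⟩ := x.left_lim s
      refine ⟨l, hl.congr' ?_⟩
      filter_upwards [self_mem_nhdsWithin] with r hr
      rw [min_eq_left (le_trans (le_of_lt hr) h)]
    · refine ⟨x.toFun t, tendsto_const_nhds.congr' ?_⟩
      filter_upwards [mem_nhdsWithin_of_mem_nhds (lt_mem_nhds h)] with r hr
      rw [min_eq_right hr.le]

/-- The path `x + h 𝟙_{[t,T]}`. -/
def Cadlag.bump (t : Icc (0 : ℝ) T) (x : Cadlag T H) (h : H) : Cadlag T H where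
  toFun s := x.toFun s + if t ≤ s then h else 0
  right_cont s := by
    refine (x.right_cont s).add ?_
    by_cases hs : t ≤ s
    · refine (continuousWithinAt_const (b := h)).congr (fun r hr => ?_) ?_
      · rw [if_pos (le_trans hs hr)]
      · rw [if_pos hs]
    · refine ContinuousAt.continuousWithinAt
        ((continuousAt_const (y := (0 : H))).congr ?_)
      filter_upwards [gt_mem_nhds (not_le.1 hs)] with r hr
      rw [if_neg (not_le.2 hr)]
  left_lim s := by
    obtain ⟨l, hl⟩ := x.left_lim s
    rcases lt_or_ge t s with h' | h'
    · refine ⟨l + h, hl.add (tendsto_const_nhds.congr' ?_)⟩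
      filter_upwards [mem_nhdsWithin_of_mem_nhds (lt_mem_nhds h')] with r hr
      rw [if_pos hr.le]
    · refine ⟨l + 0, hl.add (tendsto_const_nhds.congr' ?_)⟩
      filter_upwards [self_mem_nhdsWithin] with r hr
      rw [if_neg (not_le.2 (lt_of_lt_of_le hr h'))]

/-- A continuous path as a càdlàg path. -/
def CPath.toCadlag (x : CPath T H) : Cadlag T H where
  toFun := x
  right_cont _ := x.continuous.continuousWithinAt
  left_lim s := ⟨x s, x.continuous.continuousAt.tendsto.mono_left nhdsWithin_le_nhds⟩

/-- The Skorokhod distance. The increasing order isomorphisms of `[0,T]` are the strictly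
increasing continuous maps of `[0,T]` into itself that fix `0` and `T`. -/
instance Cadlag.instPseudoEMetricSpace : PseudoEMetricSpace (Cadlag T H) where
  edist x y := ⨅ l : Icc (0 : ℝ) T ≃o Icc (0 : ℝ) T,
    ⨆ s, (edist s (l s) + edist (x.toFun s) (y.toFun (l s)))
  edist_self x := by
    refine le_antisymm (iInf_le_of_le (OrderIso.refl _) ?_) bot_le
    simp
  edist_comm := by
    have key : ∀ x y : Cadlag T H,
        (⨅ l : Icc (0 : ℝ) T ≃o Icc (0 : ℝ) T,
          ⨆ s, (edist s (l s) + edist (x.toFun s) (y.toFun (l s)))) ≤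
        ⨅ l : Icc (0 : ℝ) T ≃o Icc (0 : ℝ) T,
          ⨆ s, (edist s (l s) + edist (y.toFun s) (x.toFun (l s))) := by
      intro x y
      refine le_iInf fun l => iInf_le_of_le l.symm (iSup_le fun s => ?_)
      refine le_trans (le_of_eq ?_)
        (le_iSup (fun s => edist s (l s) + edist (y.toFun s) (x.toFun (l s))) (l.symm s))
      simp [edist_comm]
    exact fun x y => le_antisymm (key x y) (key y x)
  edist_triangle x y z := by
    simp only [ENNReal.iInf_add, ENNReal.add_iInf]
    refine le_iInf fun m => le_iInf fun l => iInf_le_of_le (l.trans m) (iSup_le fun s => ?_)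
    have h₁ := le_iSup (fun s => edist s (l s) + edist (x.toFun s) (y.toFun (l s))) s
    have h₂ := le_iSup (fun s => edist s (m s) + edist (y.toFun s) (z.toFun (m s))) (l s)
    refine le_trans ?_ (add_le_add h₁ h₂)
    rw [add_add_add_comm]
    exact add_le_add (edist_triangle _ _ _) (edist_triangle _ _ _)

instance Cadlag.instMeasurableSpace : MeasurableSpace (Cadlag T H) := borel _

instance Cadlag.instBorelSpace : BorelSpace (Cadlag T H) := ⟨rfl⟩

lemma CPath.edist_toCadlag_le (x y : CPath T H) : edist x.toCadlag y.toCadlag ≤ edist x y := by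
  refine iInf_le_of_le (OrderIso.refl _) (iSup_le fun s => ?_)
  have h : edist (x s) (y s) ≤ edist x y := by
    rw [edist_dist, edist_dist]
    exact ENNReal.ofReal_le_ofReal (ContinuousMap.dist_apply_le_dist s)
  simpa [CPath.toCadlag] using h

lemma CPath.continuous_toCadlag : Continuous (CPath.toCadlag : CPath T H → Cadlag T H) :=
  (LipschitzWith.of_edist_le CPath.edist_toCadlag_le).continuous

/-- The law on `D([0,T];H)` of a law on `C([0,T];H)`. -/
def P2.toCadlag (μ : P2 (CPath T H)) : P2 (Cadlag T H) where
  toMeasure := μ.toMeasure.map CPath.toCadlag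
  isProb := by
    have := μ.isProb
    exact Measure.isProbabilityMeasure_map CPath.continuous_toCadlag.measurable.aemeasurable
  moment := by
    obtain ⟨x₀, h⟩ := μ.moment
    refine ⟨x₀.toCadlag, lt_of_le_of_lt (lintegral_map_le _ _) (lt_of_le_of_lt ?_ h)⟩
    exact lintegral_mono fun x => pow_le_pow_left' (CPath.edist_toCadlag_le _ _) 2

end Paths

/-! ### The probabilistic setting -/

section Setting

variable {Ω : Type*} [MeasurableSpace Ω] (P : Measure Ω)

/-- `B` is a `K`-valued cylindrical Brownian motion, `B t k` being the real random variable
`⟨B_t, k⟩`. -/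
structure IsCylindricalBrownianMotion {K : Type*} [NormedAddCommGroup K] [InnerProductSpace ℝ K]
    (B : ℝ≥0 → K → Ω → ℝ) : Prop where
  measurable : ∀ t k, Measurable (B t k)
  linear : ∀ t (c : ℝ) k l, B t (c • k + l) =ᵐ[P] fun ω => c * B t k ω + B t l ω
  brownian : ∀ k, ‖k‖ = 1 → IsBrownianReal (fun t => B t k) P
  indep : ∀ (n : ℕ) (e : Fin n → K), Orthonormal ℝ e → iIndepFun (fun i ω t => B t (e i) ω) P

/-- The `P`-completed filtration generated by `B`. -/
@[reducible] def brownianFiltration {K : Type*} (B : ℝ≥0 → K → Ω → ℝ) (t : ℝ) : MeasurableSpace Ω :=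
  (⨆ (s : ℝ≥0) (_ : (s : ℝ) ≤ t) (k : K), MeasurableSpace.comap (B s k) inferInstance) ⊔
    MeasurableSpace.generateFrom {N | P N = 0}

end Setting

/-- `ξ ∈ 𝐒₂(m)`: a continuous, `ℬ([0,T]) ⊗ m`-measurable process with `E‖ξ‖_T² < ∞`. -/
structure IsS2 {Ω : Type*} (m : MeasurableSpace Ω) {mΩ : MeasurableSpace Ω} (P : Measure Ω)
    {T : ℝ} {H : Type*} [NormedAddCommGroup H] [MeasurableSpace H] (ξ : Ω → CPath T H) : Prop where
  measurable : Measurable[(inferInstance : MeasurableSpace (Icc (0 : ℝ) T)).prod m]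
    fun p : Icc (0 : ℝ) T × Ω => ξ p.2 p.1
  moment : ∫⁻ ω, ‖ξ ω‖ₑ ^ 2 ∂P < ∞

/-- The probabilistic setting: `B` is a cylindrical Brownian motion, and the sub-`σ`-algebra `𝒢` is
independent of `B` and rich enough to carry every law in `𝒫₂(C([0,T];H))`. -/
structure IsSetting {Ω : Type*} (G : MeasurableSpace Ω) {mΩ : MeasurableSpace Ω} (P : Measure Ω)
    (T : ℝ) (H : Type*) [NormedAddCommGroup H] [MeasurableSpace H]
    {K : Type*} [NormedAddCommGroup K] [InnerProductSpace ℝ K] (B : ℝ≥0 → K → Ω → ℝ) : Prop where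
  isCylBM : IsCylindricalBrownianMotion P B
  le : G ≤ mΩ
  indep : Indep G (⨆ t : ℝ≥0, brownianFiltration P B t) P
  rich : ∀ μ : P2 (CPath T H), ∃ ξ : Ω → CPath T H, IsS2 G P ξ ∧ P.map ξ = μ.toMeasure

/-- The filtration `ℱ_t = 𝒢 ∨ ℱ_t^B`. -/
@[reducible] def filtration {Ω : Type*} (G : MeasurableSpace Ω) {mΩ : MeasurableSpace Ω} (P : Measure Ω)
    {K : Type*} (B : ℝ≥0 → K → Ω → ℝ) (t : ℝ) : MeasurableSpace Ω :=
  G ⊔ brownianFiltration P B t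


/-! ### Pathwise derivatives -/

section Derivatives

variable {Ω : Type*} [MeasurableSpace Ω] (P : Measure Ω) [IsProbabilityMeasure P]
  {T : ℝ} {H : Type*} [NormedAddCommGroup H] [InnerProductSpace ℝ H] [CompleteSpace H]
  [MeasurableSpace H]

variable (T H) in
/-- `L²(Ω; D([0,T];H))`. -/
structure L2Cadlag where
  toFun : Ω → Cadlag T H
  measurable : Measurable toFun
  moment : ∃ x₀, ∫⁻ ω, edist x₀ (toFun ω) ^ 2 ∂P < ∞

variable {P} in
/-- The law of an element of `L²(Ω; D([0,T];H))`. -/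
def L2Cadlag.law (ξ : L2Cadlag P T H) : P2 (Cadlag T H) where
  toMeasure := P.map ξ.toFun
  isProb := Measure.isProbabilityMeasure_map ξ.measurable.aemeasurable
  moment := by
    obtain ⟨x₀, h⟩ := ξ.moment
    exact ⟨x₀, lt_of_le_of_lt (lintegral_map_le _ _) h⟩

/-- The pseudo-distance `(|t-t'|² + 𝒲₂(μ_{[0,t]}, μ'_{[0,t']})²)^{1/2}` on
`[0,T] × 𝒫₂(D([0,T];H))`. -/
def distH (p q : Icc (0 : ℝ) T × P2 (Cadlag T H)) : ℝ≥0∞ :=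
  (edist p.1 q.1 ^ 2 + wass (p.2.toMeasure.map (Cadlag.stoppedAt p.1))
    (q.2.toMeasure.map (Cadlag.stoppedAt q.1)) ^ 2) ^ (1 / 2 : ℝ)

/-- The pseudo-distance on `[0,T] × 𝒫₂(D([0,T];H)) × D([0,T];H)` used for the continuity of
non-anticipative functions: `(tₙ, μₙ, xₙ)` converges to `(t, μ, x)` when `(tₙ, μₙ) → (t, μ)` for
`distH` and both the paths `xₙ` and the stopped paths `xₙ(· ∧ tₙ)` converge for the Skorokhod
distance. A function that is continuous for the product of `distH` with the Skorokhod distance of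
the paths, or with the Skorokhod distance of the stopped paths, is continuous for this one. -/
def distHD (p q : Icc (0 : ℝ) T × P2 (Cadlag T H) × Cadlag T H) : ℝ≥0∞ :=
  distH (p.1, p.2.1) (q.1, q.2.1) + edist p.2.2 q.2.2 +
    edist (p.2.2.stoppedAt p.1) (q.2.2.stoppedAt q.1)

variable {P} in
/-- The corresponding pseudo-distance on `[0,T] × L²(Ω; D([0,T];H))`. -/
def distLift (p q : Icc (0 : ℝ) T × L2Cadlag P T H) : ℝ≥0∞ :=
  (edist p.1 q.1 ^ 2 + ∫⁻ ω, edist (p.2.toFun ω) (q.2.toFun ω) ^ 2 ∂P +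
    ∫⁻ ω, edist ((p.2.toFun ω).stoppedAt p.1) ((q.2.toFun ω).stoppedAt q.1) ^ 2 ∂P) ^ (1 / 2 : ℝ)

variable {P} in
/-- `Z ∈ L²(Ω;H)` is the pathwise space derivative at `(t, ξ)` of the lifting
`(t, ξ) ↦ φ(t, ℙ_ξ)` of `φ`:
`φ(t, ℙ_{ξ + Y 𝟙_{[t,T]}}) = φ(t, ℙ_ξ) + E⟨Z, Y⟩ + o(|Y|_{L²})`. -/
def HasPathwiseSpaceDerivAt (φ : Icc (0 : ℝ) T → P2 (Cadlag T H) → ℝ) (t : Icc (0 : ℝ) T)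
    (ξ : L2Cadlag P T H) (Z : Lp H 2 P) : Prop :=
  ∀ ε > 0, ∃ δ > 0, ∀ (Y : Lp H 2 P) (η : L2Cadlag P T H), ‖Y‖ < δ →
    (∀ᵐ ω ∂P, η.toFun ω = (ξ.toFun ω).bump t (Y ω)) →
    |φ t η.law - φ t ξ.law - ∫ ω, ⟪Z ω, Y ω⟫ ∂P| ≤ ε * ‖Y‖

/-- `φ ∈ 𝑪_b^{1,2}([0,T] × 𝒫₂(D([0,T];H)))`, with pathwise time derivative `dt = ∂_t φ`, pathwise
measure derivative `dm = ∂_μ φ` and second-order pathwise derivative `dxm = ∂_x ∂_μ φ`. The measure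
`μ'` in `nonanticipative` and `time_deriv` is `μ_{[0,t]}`. -/
structure IsC12b (φ : Icc (0 : ℝ) T → P2 (Cadlag T H) → ℝ)
    (dt : Icc (0 : ℝ) T → P2 (Cadlag T H) → ℝ)
    (dm : Icc (0 : ℝ) T → P2 (Cadlag T H) → Cadlag T H → H)
    (dxm : Icc (0 : ℝ) T → P2 (Cadlag T H) → Cadlag T H → H →L[ℝ] H) : Prop where
  nonanticipative : ∀ t (μ μ' : P2 (Cadlag T H)),
    μ'.toMeasure = μ.toMeasure.map (Cadlag.stoppedAt t) → φ t μ = φ t μ'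
  space_deriv : ∃ D : Icc (0 : ℝ) T → L2Cadlag P T H → Lp H 2 P,
    (∀ t ξ, HasPathwiseSpaceDerivAt φ t ξ (D t ξ)) ∧
    ContinuousFor distLift (fun p : Icc (0 : ℝ) T × L2Cadlag P T H => D p.1 p.2) ∧
    ∀ t ξ, ∀ᵐ ω ∂P, D t ξ ω = dm t ξ.law (ξ.toFun ω)
  measure_deriv_measurable : ∀ t μ, Measurable (dm t μ)
  time_deriv : ∀ (t : Icc (0 : ℝ) T) (μ μ' : P2 (Cadlag T H)), (t : ℝ) < T →
    μ'.toMeasure = μ.toMeasure.map (Cadlag.stoppedAt t) →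
    Tendsto (fun s : Icc (0 : ℝ) T => (φ s μ' - φ t μ) / ((s : ℝ) - t)) (𝓝[>] t) (𝓝 (dt t μ))
  time_deriv_terminal : ∀ (t : Icc (0 : ℝ) T) (μ : P2 (Cadlag T H)), (t : ℝ) = T →
    Tendsto (fun s => dt s μ) (𝓝[<] t) (𝓝 (dt t μ))
  second_deriv : ∀ t μ (x : Cadlag T H),
    HasFDerivAt (fun h => dm t μ (x.bump t h)) (dxm t μ x) 0
  continuous : ContinuousFor distH
    (fun p : Icc (0 : ℝ) T × P2 (Cadlag T H) => φ p.1 p.2)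
  continuous_time : ContinuousFor distH
    (fun p : Icc (0 : ℝ) T × P2 (Cadlag T H) => dt p.1 p.2)
  continuous_measure : ContinuousFor distHD
    (fun p : Icc (0 : ℝ) T × P2 (Cadlag T H) × Cadlag T H => dm p.1 p.2.1 p.2.2)
  continuous_second : ContinuousFor distHD
    (fun p : Icc (0 : ℝ) T × P2 (Cadlag T H) × Cadlag T H => dxm p.1 p.2.1 p.2.2)
  bounded : ∃ C : ℝ, ∀ t μ x,
    |φ t μ| ≤ C ∧ |dt t μ| ≤ C ∧ ‖dm t μ x‖ ≤ C ∧ ‖dxm t μ x‖ ≤ C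

/-- An extension of `w : [0,T] × 𝒫₂(C([0,T];H)) → ℝ` to a function in
`𝑪_b^{1,2}([0,T] × 𝒫₂(D([0,T];H)))` that is consistent with `w`. The function `w` belongs to
`𝑪_b^{1,2}([0,T] × 𝒫₂(C([0,T];H)))` when there is one, and the pathwise derivatives of `w` are then
those of the extension. -/
structure C12bExtension (w : Icc (0 : ℝ) T → P2 (CPath T H) → ℝ) where
  ext : Icc (0 : ℝ) T → P2 (Cadlag T H) → ℝ
  extDt : Icc (0 : ℝ) T → P2 (Cadlag T H) → ℝ
  extDm : Icc (0 : ℝ) T → P2 (Cadlag T H) → Cadlag T H → H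
  extDxm : Icc (0 : ℝ) T → P2 (Cadlag T H) → Cadlag T H → H →L[ℝ] H
  isC12b : IsC12b P ext extDt extDm extDxm
  consistent : ∀ t μ, w t μ = ext t μ.toCadlag

variable {P} {w : Icc (0 : ℝ) T → P2 (CPath T H) → ℝ} (W : C12bExtension P w)

/-- `∂_t w(t,μ)`. -/
def C12bExtension.dt (t : Icc (0 : ℝ) T) (μ : P2 (CPath T H)) : ℝ := W.extDt t μ.toCadlag

/-- `∂_μ w(t,μ)(x)`. -/
def C12bExtension.dm (t : Icc (0 : ℝ) T) (μ : P2 (CPath T H)) (x : CPath T H) : H :=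
  W.extDm t μ.toCadlag x.toCadlag

/-- `∂_x ∂_μ w(t,μ)(x)`. -/
def C12bExtension.dxm (t : Icc (0 : ℝ) T) (μ : P2 (CPath T H)) (x : CPath T H) : H →L[ℝ] H :=
  W.extDxm t μ.toCadlag x.toCadlag

end Derivatives

/-! ### Random controls -/

/-- The `U`-valued random variables. -/
def RandomControl (Ω U : Type*) [MeasurableSpace Ω] [MeasurableSpace U] : Type _ :=
  {a : Ω → U // Measurable a}

/-- The law `ℙ_a` of a `U`-valued random variable. -/
def RandomControl.law {Ω U : Type*} [MeasurableSpace Ω] [MeasurableSpace U]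
    (P : Measure Ω) [IsProbabilityMeasure P] (a : RandomControl Ω U) : ProbabilityMeasure U :=
  ⟨P.map a.1, Measure.isProbabilityMeasure_map a.2.aemeasurable⟩

/-- The `U`-valued random variables that are measurable for `m`. -/
def measurableControls {Ω U : Type*} (m : MeasurableSpace Ω) {mΩ : MeasurableSpace Ω}
    [MeasurableSpace U] : Set (RandomControl Ω U) :=
  {a | Measurable[m] a.1}

/-! ### The coefficients -/

section Coefficients

variable {T : ℝ} {H K : Type*}
  [NormedAddCommGroup H] [InnerProductSpace ℝ H] [CompleteSpace H] [MeasurableSpace H]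
  [NormedAddCommGroup K] [InnerProductSpace ℝ K] [CompleteSpace K]
  (U : Type*) [TopologicalSpace U] [MeasurableSpace U] [OpensMeasurableSpace U]

variable (T H) in
/-- The type of the coefficients `c_t(x, μ, u, ν)`, with values in `V`; the time set is `[0,T]` and
`𝒫(U)` is the space of Borel probability measures with the topology of weak convergence. -/
abbrev Coef (V : Type*) : Type _ :=
  Icc (0 : ℝ) T → CPath T H → P2 (CPath T H) → U → ProbabilityMeasure U → V

variable {U}

/-- Joint Borel measurability of a coefficient. -/
def Coef.IsMeasurable {V : Type*} [MeasurableSpace V] (c : Coef T H U V) : Prop :=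
  Measurable[(inferInstance : MeasurableSpace (Icc (0 : ℝ) T)).prod
    ((inferInstance : MeasurableSpace (CPath T H)).prod
    ((inferInstance : MeasurableSpace (P2 (CPath T H))).prod
    ((inferInstance : MeasurableSpace U).prod (borel (ProbabilityMeasure U)))))]
    fun p : Icc (0 : ℝ) T × CPath T H × P2 (CPath T H) × U × ProbabilityMeasure U =>
      c p.1 p.2.1 p.2.2.1 p.2.2.2.1 p.2.2.2.2

/-- `A` is the infinitesimal generator of the `C₀`-semigroup `S`. -/
structure IsGeneratorOf (A : H →ₗ.[ℝ] H) (S : ℝ≥0 → H →L[ℝ] H) : Prop where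
  zero : S 0 = ContinuousLinearMap.id ℝ H
  add : ∀ s t, S (s + t) = (S s).comp (S t)
  strongly_continuous : ∀ x, Continuous fun t => S t x
  generator : ∀ x y, (x, y) ∈ A.graph ↔
    Tendsto (fun h : ℝ≥0 => (h : ℝ)⁻¹ • (S h x - x)) (𝓝[>] 0) (𝓝 y)

/-- The assumptions on `A`, `b`, `σ`: `A` generates a `C₀`-semigroup of pseudo-contractions, `b` and
`σ` are measurable, Lipschitz in `(x, μ)` (for the seminorm `‖x‖_t = ‖x_{·∧t}‖_T` and `𝒲₂`), and
bounded at `(0, δ₀)`. -/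
structure AssumptionAbσ (A : H →ₗ.[ℝ] H) (b : Coef T H U H) (σ : Coef T H U (HS K H)) : Prop where
  semigroup : ∃ S : ℝ≥0 → H →L[ℝ] H, IsGeneratorOf A S ∧ ∃ η : ℝ, ∀ t, ‖S t‖ ≤ Real.exp (η * t)
  measurable_b : b.IsMeasurable
  measurable_σ : σ.IsMeasurable
  lipschitz : ∃ L : ℝ,
    (∀ t x μ x' μ' u ν,
      ‖b t x μ u ν - b t x' μ' u ν‖ ≤ L * (‖CPath.stoppedAt t (x - x')‖ + μ.W2 μ')) ∧
    (∀ t x μ x' μ' u ν, hsNorm ((σ t x μ u ν).1 - (σ t x' μ' u ν).1) ≤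
      ENNReal.ofReal (L * (‖CPath.stoppedAt t (x - x')‖ + μ.W2 μ'))) ∧
    ∀ t u ν, ENNReal.ofReal ‖b t 0 (P2.dirac 0) u ν‖ + hsNorm (σ t 0 (P2.dirac 0) u ν).1 ≤
      ENNReal.ofReal L

/-- The assumptions on `f` and `g`: measurability, non-anticipativity of `f`, and quadratic growth
with a locally bounded `h : [0,∞) → [0,∞)`. -/
structure AssumptionFg (f : Coef T H U ℝ) (g : CPath T H → P2 (CPath T H) → ℝ) : Prop where
  measurable_f : f.IsMeasurable
  measurable_g : Measurable fun p : CPath T H × P2 (CPath T H) => g p.1 p.2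
  nonanticipative : ∀ t x μ u ν, f t x μ u ν = f t (CPath.stoppedAt t x) μ u ν
  growth : ∃ h : ℝ≥0 → ℝ≥0, (∀ R, ∃ M, ∀ r ≤ R, h r ≤ M) ∧
    (∀ t x μ u ν, |f t x μ u ν| ≤
      h (μ.W2 (P2.dirac 0)).toNNReal * (1 + ‖CPath.stoppedAt t x‖ ^ 2)) ∧
    ∀ x μ, |g x μ| ≤ h (μ.W2 (P2.dirac 0)).toNNReal * (1 + ‖x‖ ^ 2)

/-! ### The Hamiltonian and the Master Bellman equation -/

variable {Ω : Type*} [MeasurableSpace Ω] {P : Measure Ω} [IsProbabilityMeasure P]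
  (b : Coef T H U H) (σ : Coef T H U (HS K H)) (f : Coef T H U ℝ)
  {w : Icc (0 : ℝ) T → P2 (CPath T H) → ℝ} (W : C12bExtension P w)
  (t : Icc (0 : ℝ) T) (μ : P2 (CPath T H))

/-- The first-order part `f_t(x,μ,u,ν) + ⟨b_t(x,μ,u,ν), ∂_μ w(t,μ)(x)⟩`. -/
def firstOrder (x : CPath T H) (u : U) (ν : ProbabilityMeasure U) : ℝ :=
  f t x μ u ν + ⟪b t x μ u ν, W.dm t μ x⟫

/-- The second-order part `Tr(σ_t(x,μ,u,ν) σ_t^*(x,μ,u,ν) ∂_x ∂_μ w(t,μ)(x))`. -/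
def secondOrder (x : CPath T H) (u : U) (ν : ProbabilityMeasure U) : ℝ :=
  trace ((σ t x μ u ν).1 ∘L (ContinuousLinearMap.adjoint (σ t x μ u ν).1) ∘L W.dxm t μ x)

/-- The function `F(x,u,ν) = f + ⟨b, ∂_μ w⟩ + ½ Tr(σ σ^* ∂_x ∂_μ w)`. -/
def hamF (x : CPath T H) (u : U) (ν : ProbabilityMeasure U) : ℝ :=
  firstOrder b f W t μ x u ν + 1 / 2 * secondOrder σ W t μ x u ν

/-- The controls `ǎ(ξ, U_ξ)`, for Borel maps `ǎ : C([0,T];H) × [0,1] → U`. -/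
def randomizedFeedbacks (ξ : Ω → CPath T H) (Uξ : Ω → Icc (0 : ℝ) 1) : Set (RandomControl Ω U) :=
  {a | ∃ c : CPath T H × Icc (0 : ℝ) 1 → U, Measurable c ∧ ∀ ω, a.1 ω = c (ξ ω, Uξ ω)}

/-- The controls `a(ξ)`, for Borel maps `a : C([0,T];H) → U`. -/
def feedbacks (ξ : Ω → CPath T H) : Set (RandomControl Ω U) :=
  {a | ∃ c : CPath T H → U, Measurable c ∧ ∀ ω, a.1 ω = c (ξ ω)}

variable (ξ : Ω → CPath T H)

variable (P) in
/-- `sup_{a ∈ M} E[Φ(ξ, a, ℙ_a)]`, in `[-∞, ∞]`. -/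
def supOver (Φ : CPath T H → U → ProbabilityMeasure U → ℝ) (M : Set (RandomControl Ω U)) : EReal :=
  ⨆ a ∈ M, ((∫ ω, Φ (ξ ω) (a.1 ω) (a.law P) ∂P : ℝ) : EReal)

/-- The adjoint `A^*`, extended by `0` outside of its domain. -/
def adjointApply (A : H →ₗ.[ℝ] H) (y : H) : H :=
  open Classical in if h : y ∈ A.adjoint.domain then A.adjoint ⟨y, h⟩ else 0

/-- `∂_μ w(t,μ)(ξ) ∈ L²(Ω; D(A^*))`. -/
def InAdjointDomain (A : H →ₗ.[ℝ] H) : Prop :=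
  (∀ᵐ ω ∂P, W.dm t μ (ξ ω) ∈ A.adjoint.domain) ∧
    MemLp (fun ω => W.dm t μ (ξ ω)) 2 P ∧ MemLp (fun ω => adjointApply A (W.dm t μ (ξ ω))) 2 P

/-- The equation `∂_t w(t,μ) + E⟨ξ_t, A^* ∂_μ w(t,μ)(ξ)⟩ + 𝓗 = 0`, with Hamiltonian term `𝓗`. -/
def BellmanEq (A : H →ₗ.[ℝ] H) (ham : EReal) : Prop :=
  ((W.dt t μ + ∫ ω, ⟪ξ ω t, adjointApply A (W.dm t μ (ξ ω))⟫ ∂P : ℝ) : EReal) + ham = 0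

/-- The Hamiltonian term of the Master Bellman equation, with the supremum taken over `M`:
`sup_{a ∈ M} {E[f_t(ξ,μ,a,ℙ_a) + ⟨b_t(ξ,μ,a,ℙ_a), ∂_μ w(t,μ)(ξ)⟩]
  + ½ E[Tr(σ_t σ_t^*(ξ,μ,a,ℙ_a) ∂_x ∂_μ w(t,μ)(ξ))]}`. -/
def hamiltonian (M : Set (RandomControl Ω U)) : EReal :=
  ⨆ a ∈ M, ((∫ ω, firstOrder b f W t μ (ξ ω) (a.1 ω) (a.law P) ∂P +
    1 / 2 * ∫ ω, secondOrder σ W t μ (ξ ω) (a.1 ω) (a.law P) ∂P : ℝ) : EReal)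

end Coefficients

end MasterBellman

end

open MasterBellman

/-!
The function `F = hamF` is Borel in `(x, u)` for every fixed law `ν`, and `|F| ≤ C (1 + ‖x‖²)` with
a constant that depends on `(t, μ)` only, so that all expectations are finite. For the second-order
term this rests on `Tr(σ σ^* D) = ∑ₖ ⟨D σ eₖ, σ eₖ⟩` (`hasSum_trace`), which yields both the
measurability and the bound `‖D‖ ‖σ‖²`. By linearity, the Hamiltonian terms of the Bellman equation
are the suprema of `E[F]`, and the statements about the equation follow from those about the
suprema.

When a uniform variable `U_ξ` independent of `ξ` is available, the conditional law of a control `a`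
given `ξ` is represented as the image of the uniform law by a Borel map `c(ξ, ·)`; then
`(ξ, c(ξ, U_ξ))` and `(ξ, a)` have the same law (`exists_randomized_map_eq`), and the expectation of
`F(ξ, a, ℙ_a)` depends on this law only. Hence the controls `c(ξ, U_ξ)` already exhaust the values
attained by all controls.

When `F = F₀(x, u)`, a measurable selection theorem (`exists_measurable_selection`) is applied to
the sets `{F₀ > q}` with `q` rational. It produces countably many Borel feedbacks whose values have, for
almost every `x`, the same supremum as `F₀(x, ·)`. The maximum over the first `n` of them is again a
Borel feedback, its values increase to the essential supremum, and dominated convergence concludes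
(`exists_isEssSup_supOver_eq`). The selection theorem is proved by writing the Borel set as a
continuous image of the Baire space, exhausting its projection by images of compact sets up to a
null set, and choosing the leftmost point of each fibre after parametrizing the compact sets by
the Cantor set.
-/

namespace MasterBellman

/-! ### Measurable selection -/

section Selection

/-- The image of the Baire space under a continuous map is exhausted, in outer measure, by images of
compact sets: coordinate after coordinate is bounded at a small cost, and outer regularity passes
from these decreasing sets to the compact box that is their intersection. -/
theorem exists_isCompact_le_measure_image {X : Type*} [TopologicalSpace X] [MeasurableSpace X]
    {p : (ℕ → ℕ) → X} (hp : Continuous p)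
    (m : Measure X) [m.OuterRegular] {c : ℝ≥0∞} (hc : c < m (range p)) :
    ∃ k : Set (ℕ → ℕ), IsCompact k ∧ c ≤ m (p '' k) := by
  have step : ∀ (n : ℕ) (S : Set (ℕ → ℕ)), ∃ j : ℕ,
      c < m (p '' S) → c < m (p '' (S ∩ {y | y n ≤ j})) := by
    intro n S
    by_cases h : c < m (p '' S)
    · have hU : p '' S = ⋃ j : ℕ, p '' (S ∩ {y | y n ≤ j}) := by
        rw [← image_iUnion, ← inter_iUnion]
        congr 1
        ext y
        simpa using fun _ => ⟨y n, le_rfl⟩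
      have hmono : Monotone fun j : ℕ => p '' (S ∩ {y | y n ≤ j}) := fun i j hij =>
        image_mono (inter_subset_inter_right _ fun y (hy : y n ≤ i) => hy.trans hij)
      rw [hU, hmono.measure_iUnion, lt_iSup_iff] at h
      obtain ⟨j, hj⟩ := h
      exact ⟨j, fun _ => hj⟩
    · exact ⟨0, fun h' => absurd h' h⟩
  choose κ hκ using step
  let S : ℕ → Set (ℕ → ℕ) := fun n =>
    Nat.rec univ (fun n S => S ∩ {y | y n ≤ κ n S}) n
  let z : ℕ → ℕ := fun n => κ n (S n)
  have hSsucc : ∀ n, S (n + 1) = S n ∩ {y | y n ≤ z n} := fun n => rfl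
  have hS : ∀ n, c < m (p '' S n) := by
    intro n
    induction n with
    | zero => simpa [S, image_univ] using hc
    | succ n ih => rw [hSsucc]; exact hκ n _ ih
  have hSle : ∀ n, ∀ y ∈ S n, ∀ i < n, y i ≤ z i := by
    intro n
    induction n with
    | zero => intro _ _ i hi; omega
    | succ n ih =>
      intro y hy i hi
      rw [hSsucc] at hy
      rcases Nat.lt_succ_iff_lt_or_eq.1 hi with h | rfl
      · exact ih y hy.1 i h
      · exact hy.2
  have hk : IsCompact (univ.pi fun i => Iic (z i)) :=
    isCompact_univ_pi fun i => (finite_Iic _).isCompact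
  refine ⟨_, hk, ?_⟩
  rw [Set.measure_eq_iInf_isOpen]
  refine le_iInf₂ fun V hV => le_iInf fun hVo => ?_
  -- an open neighbourhood of the compact box contains one of the sets `S n`
  obtain ⟨n, hn⟩ : ∃ n, S n ⊆ p ⁻¹' V := by
    by_contra! hcon
    choose y hyS hyV using fun n => not_subset.1 (hcon n)
    obtain ⟨a, ha, φ, hφ, hlim⟩ := hk.tendsto_subseq
      (x := fun n i => min (y n i) (z i)) fun n i _ => mem_Iic.2 (min_le_right _ _)
    have hlim' : Tendsto (y ∘ φ) atTop (𝓝 a) := by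
      rw [tendsto_pi_nhds] at hlim ⊢
      intro i
      refine (hlim i).congr' ?_
      filter_upwards [eventually_gt_atTop i] with j hj
      exact min_eq_left (hSle _ _ (hyS _) i (hj.trans_le (hφ.id_le j)))
    exact ((hVo.preimage hp).isClosed_compl.mem_of_tendsto hlim'
      (Eventually.of_forall fun j => hyV _)) (hV (mem_image_of_mem p ha))
  exact (hS n).le.trans (measure_mono (image_subset_iff.2 hn))

variable {X : Type*} [TopologicalSpace X] [T2Space X] [MeasurableSpace X] [BorelSpace X]

/-- A continuous map on a compact set of reals has a Borel section: the leftmost point of each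
fibre, whose sublevel sets are images of compact sets. -/
theorem exists_measurable_section_of_subset_real {C : Set ℝ} (hC : IsCompact C) [Nonempty C]
    {r : C → X} (hr : Continuous r) :
    ∃ s : X → C, Measurable s ∧ ∀ x ∈ range r, r (s x) = x := by
  have : CompactSpace C := isCompact_iff_compactSpace.1 hC
  obtain ⟨c₀⟩ := ‹Nonempty C›
  have key : ∀ x, ∃ c : C, (x ∈ range r → r c = x ∧ ∀ c', r c' = x → (c : ℝ) ≤ c') ∧
      (x ∉ range r → c = c₀) := by
    intro x
    by_cases hx : x ∈ range r
    · obtain ⟨c, hc, hmin⟩ := (isClosed_singleton.preimage hr).isCompact.exists_isMinOn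
        (show (r ⁻¹' {x}).Nonempty from hx) continuous_subtype_val.continuousOn
      exact ⟨c, fun _ => ⟨hc, fun c' hc' => hmin hc'⟩, fun h => absurd hx h⟩
    · exact ⟨c₀, fun h => absurd h hx, fun _ => rfl⟩
  choose s hs hs₀ using key
  refine ⟨s, ?_, fun x hx => (hs x hx).1⟩
  have hrange : MeasurableSet (range r) := (isCompact_range hr).measurableSet
  suffices h : Measurable fun x => (s x : ℝ) from h.subtype_mk
  refine measurable_of_Iic fun a => ?_
  have : (fun x => (s x : ℝ)) ⁻¹' Iic a =
      r '' {c | (c : ℝ) ≤ a} ∪ ((range r)ᶜ ∩ {_x | (c₀ : ℝ) ≤ a}) := by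
    ext x
    by_cases hx : x ∈ range r
    · simp only [mem_preimage, mem_Iic, mem_union, mem_inter_iff, mem_compl_iff, hx,
        not_true_eq_false, false_and, or_false]
      exact ⟨fun h => ⟨s x, h, (hs x hx).1⟩, fun ⟨c, hc, hcx⟩ => ((hs x hx).2 c hcx).trans hc⟩
    · have : x ∉ r '' {c | (c : ℝ) ≤ a} := fun h => hx (image_subset_range _ _ h)
      simp [this, hs₀ x hx, -mem_range, hx]
  rw [this]
  refine ((IsClosed.isCompact ?_).image hr).measurableSet.union
    (hrange.compl.inter (MeasurableSet.const _))
  exact isClosed_le continuous_subtype_val continuous_const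

/-- A continuous map on a compact metrizable set has a Borel section, since such a set is a
continuous image of the Cantor set. -/
theorem exists_measurable_section_of_isCompact {Z : Type*} [MetricSpace Z] [MeasurableSpace Z]
    [BorelSpace Z] {p : Z → X} (hp : Continuous p) {k : Set Z} (hk : IsCompact k)
    (hne : k.Nonempty) : ∃ s : X → Z, Measurable s ∧ ∀ x ∈ p '' k, p (s x) = x := by
  have : CompactSpace k := isCompact_iff_compactSpace.1 hk
  have : Nonempty k := hne.to_subtype
  obtain ⟨f, hf, hfs⟩ := exists_nat_bool_continuous_surjective_of_compact k
  let q : cantorSet → Z := fun c => f (cantorSetHomeomorphNatToBool c)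
  have hq : Continuous q :=
    continuous_subtype_val.comp (hf.comp cantorSetHomeomorphNatToBool.continuous)
  have : Nonempty cantorSet := cantorSetHomeomorphNatToBool.toEquiv.nonempty
  obtain ⟨s, hs, hsec⟩ := exists_measurable_section_of_subset_real isCompact_cantorSet
    (hp.comp hq)
  refine ⟨q ∘ s, hq.measurable.comp hs, ?_⟩
  rintro _ ⟨y, hy, rfl⟩
  refine hsec _ ?_
  obtain ⟨d, hd⟩ := hfs ⟨y, hy⟩
  exact ⟨cantorSetHomeomorphNatToBool.symm d, by simp [q, hd]⟩

/-- The sections over an exhausting sequence of compact sets are glued into one Borel map, a section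
outside a null set. -/
theorem exists_measurable_ae_section {p : (ℕ → ℕ) → X} (hp : Continuous p) (m : Measure X)
    [IsFiniteMeasure m] [m.OuterRegular] :
    ∃ s : X → ℕ → ℕ, Measurable s ∧ ∀ᵐ x ∂m, x ∈ range p → p (s x) = x := by
  let _ := TopologicalSpace.metrizableSpaceMetric (ℕ → ℕ)
  by_cases h0 : m (range p) = 0
  · refine ⟨fun _ _ => 0, measurable_const, ?_⟩
    filter_upwards [measure_eq_zero_iff_ae_notMem.1 h0] with x hx h using absurd h hx
  obtain ⟨u, -, hu, hulim⟩ := exists_seq_strictMono_tendsto' (pos_iff_ne_zero.2 h0)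
  choose k hk hkc using fun n => exists_isCompact_le_measure_image hp m (hu n).2
  have hne : ∀ n, (k n).Nonempty := by
    intro n
    by_contra h
    have := hkc n
    simp [not_nonempty_iff_eq_empty.1 h] at this
    exact absurd this (hu n).1.ne'
  choose s hs hsec using fun n => exists_measurable_section_of_isCompact hp (hk n) (hne n)
  have hD : ∀ n, MeasurableSet (p '' k n) := fun n => ((hk n).image hp).measurableSet
  set D := ⋃ n, p '' k n with hDdef
  have hDm : MeasurableSet D := MeasurableSet.iUnion hD
  have hDsub : D ⊆ range p := iUnion_subset fun n => image_subset_range _ _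
  have hmD : m (range p) ≤ m D :=
    le_of_tendsto' hulim fun n => (hkc n).trans (measure_mono (subset_iUnion (fun n => p '' k n) n))
  have hnull : m (range p \ D) = 0 := by
    have := measure_sdiff hDsub hDm.nullMeasurableSet (measure_ne_top m D)
    rw [this, tsub_eq_zero_of_le hmD]
  have hfind : ∀ x, ∃ n, x ∈ p '' k n ∨ x ∉ D := by
    intro x
    by_cases hx : x ∈ D
    · exact (mem_iUnion.1 hx).imp fun n => Or.inl
    · exact ⟨0, Or.inr hx⟩
  classical
  refine ⟨fun x => s (Nat.find (hfind x)) x,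
    Measurable.find (p := fun n x => x ∈ p '' k n ∨ x ∉ D) hs
      (fun n => (hD n).union hDm.compl) hfind, ?_⟩
  filter_upwards [measure_eq_zero_iff_ae_notMem.1 hnull] with x hx hxr
  have hxD : x ∈ D := by
    by_contra h
    exact hx ⟨hxr, h⟩
  exact hsec _ x ((Nat.find_spec (hfind x)).resolve_right (not_not.2 hxD))

end Selection

/-- Measurable selection almost everywhere: for a Borel set `S` in `X × Y` there is a Borel map
whose graph lies in `S` over almost every point of the projection of `S`, which need not be Borel. -/
theorem exists_measurable_selection {X Y : Type*} [TopologicalSpace X] [PolishSpace X]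
    [MeasurableSpace X] [BorelSpace X] [MeasurableSpace Y] [StandardBorelSpace Y] [Nonempty Y]
    (m : Measure X) [IsFiniteMeasure m] {S : Set (X × Y)} (hS : MeasurableSet S) :
    ∃ a : X → Y, Measurable a ∧ ∀ᵐ x ∂m, (∃ y, (x, y) ∈ S) → (x, a x) ∈ S := by
  let _ := upgradeStandardBorel Y
  have hana := hS.analyticSet
  rw [AnalyticSet] at hana
  rcases hana with rfl | ⟨φ, hφ, hrange⟩
  · exact ⟨fun _ => Classical.arbitrary Y, measurable_const, by simp⟩
  obtain ⟨s, hs, hsec⟩ := exists_measurable_ae_section (continuous_fst.comp hφ) m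
  refine ⟨fun x => (φ (s x)).2, hφ.measurable.snd.comp hs, ?_⟩
  filter_upwards [hsec] with x hx ⟨y, hy⟩
  rw [← hrange] at hy ⊢
  obtain ⟨z, hz⟩ := hy
  have : (φ (s x)).1 = x := hx ⟨z, by simp [hz]⟩
  exact ⟨s x, Prod.ext this rfl⟩

/-! ### Hilbert–Schmidt operators -/

section Operators

variable {H K : Type*} [NormedAddCommGroup K] [InnerProductSpace ℝ K] [CompleteSpace K]
  [NormedAddCommGroup H] [InnerProductSpace ℝ H]

theorem countable_onbIndex (E : Type*) [NormedAddCommGroup E] [InnerProductSpace ℝ E]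
    [CompleteSpace E] [TopologicalSpace.SeparableSpace E] : Countable (OnbIndex E) := by
  -- orthonormal vectors are at distance `√2`, so balls of radius `1/2` around them are disjoint
  have hdist : ∀ i j, i ≠ j → 1 ≤ dist (onb E i) (onb E j) := by
    intro i j hij
    have h := norm_sub_sq_real (onb E i) (onb E j)
    rw [(onb E).orthonormal.2 hij, (onb E).orthonormal.1 i, (onb E).orthonormal.1 j] at h
    rw [dist_eq_norm]
    nlinarith [norm_nonneg (onb E i - onb E j)]
  refine Pairwise.countable_of_isOpen_disjoint (s := fun i => Metric.ball (onb E i) (1 / 2))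
    (fun i j hij => Metric.ball_disjoint_ball ?_) (fun _ => Metric.isOpen_ball)
    fun i => Metric.nonempty_ball.2 (by norm_num)
  have := hdist i j hij
  linarith

theorem hsNorm_sq (F : K →L[ℝ] H) : hsNorm F ^ 2 = ∑' i, ‖F (onb K i)‖ₑ ^ 2 := by
  rw [hsNorm, ← ENNReal.rpow_natCast, ← ENNReal.rpow_mul]
  norm_num

theorem enorm_apply_onb_le_hsNorm (F : K →L[ℝ] H) (i : OnbIndex K) :
    ‖F (onb K i)‖ₑ ≤ hsNorm F := by
  have : ‖F (onb K i)‖ₑ ^ 2 ≤ hsNorm F ^ 2 := by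
    rw [hsNorm_sq]
    exact ENNReal.le_tsum (f := fun i => ‖F (onb K i)‖ₑ ^ 2) i
  exact (ENNReal.pow_le_pow_left_iff two_ne_zero).1 this

theorem summable_and_tsum_le_of_hsNorm_le {F : K →L[ℝ] H} {c : ℝ} (hc : 0 ≤ c)
    (h : hsNorm F ≤ ENNReal.ofReal c) :
    Summable (fun i => ‖F (onb K i)‖ ^ 2) ∧ ∑' i, ‖F (onb K i)‖ ^ 2 ≤ c ^ 2 := by
  have h2 : ∑' i, ENNReal.ofReal (‖F (onb K i)‖ ^ 2) ≤ ENNReal.ofReal (c ^ 2) := by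
    rw [ENNReal.ofReal_pow hc]
    refine le_trans (le_of_eq ?_) (pow_le_pow_left' h 2)
    rw [hsNorm_sq]
    simp_rw [ENNReal.ofReal_pow (norm_nonneg _), ofReal_norm]
  have hs : Summable (fun i => ‖F (onb K i)‖ ^ 2) := by
    have := ENNReal.summable_toReal (h2.trans_lt ENNReal.ofReal_lt_top).ne
    simpa using this
  refine ⟨hs, ?_⟩
  rw [← ENNReal.ofReal_tsum_of_nonneg (fun _ => by positivity) hs] at h2
  exact (ENNReal.ofReal_le_ofReal_iff (by positivity)).1 h2

/-- A triangle inequality for squared Hilbert–Schmidt norms, with the factor `2` that a termwise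
estimate gives. -/
theorem summable_and_tsum_le_of_hsNorm_sub_le {F G : K →L[ℝ] H} {c d : ℝ} (hc : 0 ≤ c) (hd : 0 ≤ d)
    (h : hsNorm (F - G) ≤ ENNReal.ofReal c) (hG : hsNorm G ≤ ENNReal.ofReal d) :
    Summable (fun i => ‖F (onb K i)‖ ^ 2) ∧
      ∑' i, ‖F (onb K i)‖ ^ 2 ≤ 2 * (c ^ 2 + d ^ 2) := by
  obtain ⟨h1, h1'⟩ := summable_and_tsum_le_of_hsNorm_le hc h
  obtain ⟨h2, h2'⟩ := summable_and_tsum_le_of_hsNorm_le hd hG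
  have hle : ∀ i, ‖F (onb K i)‖ ^ 2 ≤ 2 * (‖(F - G) (onb K i)‖ ^ 2 + ‖G (onb K i)‖ ^ 2) := by
    intro i
    have := norm_add_le ((F - G) (onb K i)) (G (onb K i))
    simp only [sub_apply, sub_add_cancel] at this ⊢
    exact (pow_le_pow_left₀ (norm_nonneg _) this 2).trans add_sq_le
  have hs := (h1.add h2).mul_left 2
  have hF := Summable.of_nonneg_of_le (fun _ => by positivity) hle hs
  refine ⟨hF, (hF.tsum_le_tsum hle hs).trans ?_⟩
  rw [tsum_mul_left, h1.tsum_add h2]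
  gcongr

theorem HS.measurable_apply_onb [CompleteSpace H] [MeasurableSpace H] [BorelSpace H]
    (i : OnbIndex K) :
    Measurable fun F : HS K H => F.1 (onb K i) := by
  refine measurable_of_isOpen fun O hO => MeasurableSpace.measurableSet_generateFrom ?_
  intro F hF
  obtain ⟨ε, hε, hball⟩ := EMetric.isOpen_iff.1 hO _ hF
  refine ⟨ε, hε, fun G hG => hball ?_⟩
  rw [Metric.mem_eball, edist_comm, edist_eq_enorm_sub]
  exact (enorm_apply_onb_le_hsNorm (F.1 - G.1) i).trans_lt hG

theorem hasSum_sq_inner_hilbertBasis {ι E : Type*} [NormedAddCommGroup E] [InnerProductSpace ℝ E]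
    [CompleteSpace E] (e : HilbertBasis ι ℝ E) (x : E) :
    HasSum (fun i => ⟪e i, x⟫ ^ 2) (‖x‖ ^ 2) := by
  have := e.hasSum_inner_mul_inner x x
  simpa [real_inner_comm, sq, real_inner_self_eq_norm_mul_norm] using this

variable [CompleteSpace H]

/-- The trace of `F F^* D` can be computed on an orthonormal basis of the source of the
Hilbert–Schmidt operator `F`: both are iterated sums of one absolutely summable family. -/
theorem hasSum_trace {F : K →L[ℝ] H} (hF : Summable (fun i => ‖F (onb K i)‖ ^ 2))
    (D : H →L[ℝ] H) :
    HasSum (fun k => ⟪D (F (onb K k)), F (onb K k)⟫)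
      (trace (F ∘L ContinuousLinearMap.adjoint F ∘L D)) := by
  let a : OnbIndex K → OnbIndex H → ℝ := fun k i =>
    ⟪onb H i, ContinuousLinearMap.adjoint D (F (onb K k))⟫
  let c : OnbIndex K → OnbIndex H → ℝ := fun k i => ⟪onb H i, F (onb K k)⟫
  have ha : ∀ k, HasSum (fun i => a k i ^ 2) (‖ContinuousLinearMap.adjoint D (F (onb K k))‖ ^ 2) :=
    fun k => hasSum_sq_inner_hilbertBasis _ _
  have hc : ∀ k, HasSum (fun i => c k i ^ 2) (‖F (onb K k)‖ ^ 2) :=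
    fun k => hasSum_sq_inner_hilbertBasis _ _
  -- the double family `a c` is dominated by `a² + c²`, so its two iterated sums agree
  have hac : Summable fun p : OnbIndex K × OnbIndex H => a p.1 p.2 ^ 2 + c p.1 p.2 ^ 2 := by
    rw [summable_prod_of_nonneg fun _ => by positivity]
    refine ⟨fun k => ((ha k).add (hc k)).summable, ?_⟩
    simp_rw [fun k => ((ha k).add (hc k)).tsum_eq]
    refine Summable.add (Summable.of_nonneg_of_le (fun _ => by positivity) (fun k => ?_)
      (hF.mul_left (‖ContinuousLinearMap.adjoint D‖ ^ 2))) hF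
    rw [← mul_pow]
    gcongr
    exact ContinuousLinearMap.le_opNorm _ _
  have hg : Summable fun p : OnbIndex K × OnbIndex H => a p.1 p.2 * c p.1 p.2 := by
    refine Summable.of_norm_bounded hac fun p => ?_
    rw [Real.norm_eq_abs, abs_le]
    constructor <;> nlinarith [sq_nonneg (a p.1 p.2 + c p.1 p.2),
      sq_nonneg (a p.1 p.2 - c p.1 p.2), sq_nonneg (a p.1 p.2), sq_nonneg (c p.1 p.2)]
  have hrow : ∀ k, HasSum (fun i => a k i * c k i) ⟪D (F (onb K k)), F (onb K k)⟫ := by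
    intro k
    have := (onb H).hasSum_inner_mul_inner
      (ContinuousLinearMap.adjoint D (F (onb K k))) (F (onb K k))
    rw [ContinuousLinearMap.adjoint_inner_left, real_inner_comm] at this
    simpa only [real_inner_comm (onb H _) (ContinuousLinearMap.adjoint D _)] using this
  have hcol : ∀ i, HasSum (fun k => a k i * c k i)
      ⟪(F ∘L ContinuousLinearMap.adjoint F ∘L D) (onb H i), onb H i⟫ := by
    intro i
    have := (onb K).hasSum_inner_mul_inner
      (ContinuousLinearMap.adjoint F (D (onb H i))) (ContinuousLinearMap.adjoint F (onb H i))
    simp only [ContinuousLinearMap.adjoint_inner_left,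
      ContinuousLinearMap.adjoint_inner_right] at this
    simpa only [a, c, ContinuousLinearMap.adjoint_inner_right, ContinuousLinearMap.comp_apply,
      real_inner_comm (onb H i)] using this
  have htr : trace (F ∘L ContinuousLinearMap.adjoint F ∘L D) =
      ∑' p : OnbIndex K × OnbIndex H, a p.1 p.2 * c p.1 p.2 := by
    rw [trace, hg.tsum_prod, Summable.tsum_comm (f := fun i k => a k i * c k i) hg.prod_symm]
    exact tsum_congr fun i => (hcol i).tsum_eq.symm
  rw [htr]
  exact hg.hasSum.prod_fiberwise hrow

theorem abs_trace_le {F : K →L[ℝ] H} (hF : Summable (fun i => ‖F (onb K i)‖ ^ 2))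
    (D : H →L[ℝ] H) :
    |trace (F ∘L ContinuousLinearMap.adjoint F ∘L D)| ≤ ‖D‖ * ∑' i, ‖F (onb K i)‖ ^ 2 := by
  rw [← (hasSum_trace hF D).tsum_eq, ← Real.norm_eq_abs]
  refine tsum_of_norm_bounded (hF.hasSum.mul_left _) fun i => ?_
  calc ‖⟪D (F (onb K i)), F (onb K i)⟫‖ ≤ ‖D (F (onb K i))‖ * ‖F (onb K i)‖ :=
        norm_inner_le_norm _ _
    _ ≤ ‖D‖ * ‖F (onb K i)‖ * ‖F (onb K i)‖ := by gcongr; exact D.le_opNorm _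
    _ = ‖D‖ * ‖F (onb K i)‖ ^ 2 := by ring

end Operators

/-! ### Continuous paths -/

section Paths

variable {T : ℝ} {H : Type*} [NormedAddCommGroup H]

theorem CPath.norm_stoppedAt_le (t : Icc (0 : ℝ) T) (x : CPath T H) :
    ‖CPath.stoppedAt t x‖ ≤ ‖x‖ :=
  (ContinuousMap.norm_le _ (norm_nonneg _)).2 fun s => x.norm_coe_le_norm (min s t)

/-- The Borel `σ`-algebra of `C([0,T];H)` is generated by the evaluations. -/
theorem CPath.measurable_of_eval [TopologicalSpace.SeparableSpace H] [MeasurableSpace H]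
    [BorelSpace H] {Ω : Type*} [MeasurableSpace Ω] {ξ : Ω → CPath T H}
    (h : ∀ s, Measurable fun ω => ξ ω s) : Measurable ξ := by
  have := UniformSpace.secondCountable_of_separable H
  have hball : ∀ y r, MeasurableSet (ξ ⁻¹' Metric.closedBall y r) := by
    intro y r
    rcases lt_or_ge r 0 with hr | hr
    · simp [Metric.closedBall_eq_empty.2 hr]
    obtain ⟨D, hDc, hD⟩ := TopologicalSpace.exists_countable_dense (Icc (0 : ℝ) T)
    have : ξ ⁻¹' Metric.closedBall y r = ⋂ s ∈ D, {ω | dist (ξ ω s) (y s) ≤ r} := by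
      ext ω
      simp only [mem_preimage, Metric.mem_closedBall, mem_iInter, mem_ofPred_eq]
      rw [ContinuousMap.dist_le hr]
      refine ⟨fun h s _ => h s, fun h s => ?_⟩
      have hcl : IsClosed {s | dist (ξ ω s) (y s) ≤ r} :=
        isClosed_le (by fun_prop) continuous_const
      exact (hcl.closure_subset_iff.2 h) (hD s)
    rw [this]
    exact MeasurableSet.biInter hDc fun s _ =>
      measurableSet_le ((h s).dist measurable_const) measurable_const
  have hdist : ∀ y, Measurable fun ω => dist (ξ ω) y := fun y =>
    measurable_of_Iic fun r => hball y r
  have hbasis : TopologicalSpace.IsTopologicalBasis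
      {V : Set (CPath T H) | ∃ y r, V = Metric.ball y r} := by
    refine TopologicalSpace.isTopologicalBasis_of_isOpen_of_nhds ?_ ?_
    · rintro _ ⟨y, r, rfl⟩
      exact Metric.isOpen_ball
    · intro y V hy hV
      obtain ⟨r, hr, hsub⟩ := Metric.isOpen_iff.1 hV y hy
      exact ⟨_, ⟨y, r, rfl⟩, Metric.mem_ball_self hr, hsub⟩
  rw [BorelSpace.measurable_eq (α := CPath T H), hbasis.borel_eq_generateFrom]
  refine measurable_generateFrom ?_
  rintro _ ⟨y, r, rfl⟩
  exact hdist y measurableSet_Iio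

end Paths

/-! ### Measurability and growth of the Hamiltonian -/

section Hamiltonian

theorem wass_self {S : Type*} [PseudoEMetricSpace S] [MeasurableSpace S] (ν : Measure S) :
    wass ν ν = 0 := by
  have hd : Measurable fun x : S => (x, x) := measurable_id.prodMk measurable_id
  have h : (⨅ π ∈ {π : Measure (S × S) | π.map Prod.fst = ν ∧ π.map Prod.snd = ν},
      ∫⁻ p, edist p.1 p.2 ^ 2 ∂π) = 0 := by
    refine le_antisymm (iInf₂_le_of_le (ν.map fun x => (x, x)) ⟨?_, ?_⟩ ?_) bot_le
    · rw [Measure.map_map measurable_fst hd]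
      exact Measure.map_id
    · rw [Measure.map_map measurable_snd hd]
      exact Measure.map_id
    · refine (lintegral_map_le _ _).trans ?_
      simp
  rw [wass, h]
  norm_num

theorem distHD_toCadlag_le {T : ℝ} {H : Type*} [NormedAddCommGroup H] (t : Icc (0 : ℝ) T)
    (ν : P2 (Cadlag T H)) (x y : CPath T H) :
    distHD (t, ν, x.toCadlag) (t, ν, y.toCadlag) ≤ 2 * edist x y := by
  have h1 := CPath.edist_toCadlag_le x y
  have h2 : edist (x.toCadlag.stoppedAt t) (y.toCadlag.stoppedAt t) ≤ edist x y := by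
    refine (CPath.edist_toCadlag_le (CPath.stoppedAt t x) (CPath.stoppedAt t y)).trans ?_
    rw [edist_dist, edist_dist]
    exact ENNReal.ofReal_le_ofReal ((ContinuousMap.dist_le dist_nonneg).2
      fun s => ContinuousMap.dist_apply_le_dist (min s t))
  have h0 : distH (t, ν) (t, ν) = 0 := by
    simp [distH, wass_self]
  rw [distHD, h0, zero_add, two_mul]
  exact add_le_add h1 h2

/-- A function that is continuous for `distHD` is continuous in the path alone. -/
theorem continuous_of_continuousFor_distHD {T : ℝ} {H : Type*} [NormedAddCommGroup H]
    {V : Type*} [PseudoEMetricSpace V]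
    {φ : Icc (0 : ℝ) T → P2 (Cadlag T H) → Cadlag T H → V}
    (h : ContinuousFor distHD
      (fun p : Icc (0 : ℝ) T × P2 (Cadlag T H) × Cadlag T H => φ p.1 p.2.1 p.2.2))
    (t : Icc (0 : ℝ) T) (ν : P2 (Cadlag T H)) :
    Continuous fun x : CPath T H => φ t ν x.toCadlag := by
  refine continuous_iff_continuousAt.2 fun x => EMetric.tendsto_nhds.2 fun ε hε => ?_
  obtain ⟨δ, hδ, hball⟩ := h (t, ν, x.toCadlag) ε hε
  have hlim : Tendsto (fun y => 2 * edist x y) (𝓝 x) (𝓝 0) := by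
    have : Tendsto (fun y => edist x y) (𝓝 x) (𝓝 0) := by
      simpa using (continuous_const.edist continuous_id).tendsto (f := fun y => edist x y) x
    simpa using ENNReal.Tendsto.const_mul this (Or.inr (by norm_num))
  filter_upwards [hlim.eventually_lt_const hδ] with y hy
  rw [edist_comm]
  exact hball (t, ν, y.toCadlag) ((distHD_toCadlag_le t ν x y).trans_lt hy)

section Derivatives

variable {Ω : Type*} [MeasurableSpace Ω] {P : Measure Ω} [IsProbabilityMeasure P]
  {T : ℝ} {H : Type*} [NormedAddCommGroup H] [InnerProductSpace ℝ H]
  [MeasurableSpace H] {w : Icc (0 : ℝ) T → P2 (CPath T H) → ℝ} (W : C12bExtension P w)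
  (t : Icc (0 : ℝ) T) (μ : P2 (CPath T H))

theorem C12bExtension.exists_bound :
    ∃ C : ℝ, 0 ≤ C ∧ ∀ x, ‖W.dm t μ x‖ ≤ C ∧ ‖W.dxm t μ x‖ ≤ C := by
  obtain ⟨C, hC⟩ := W.isC12b.bounded
  have h := fun x => hC t μ.toCadlag (CPath.toCadlag x)
  exact ⟨C, (norm_nonneg _).trans (h 0).2.2.1, fun x => (h x).2.2⟩

theorem C12bExtension.continuous_dm : Continuous (W.dm t μ) :=
  continuous_of_continuousFor_distHD W.isC12b.continuous_measure t _

theorem C12bExtension.continuous_dxm : Continuous (W.dxm t μ) :=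
  continuous_of_continuousFor_distHD W.isC12b.continuous_second t _

end Derivatives

theorem Coef.IsMeasurable.measurable_section {T : ℝ} {H : Type*} [NormedAddCommGroup H]
    {U : Type*} [TopologicalSpace U] [MeasurableSpace U] [OpensMeasurableSpace U]
    {V : Type*} [MeasurableSpace V] {c : Coef T H U V}
    (hc : c.IsMeasurable) (t : Icc (0 : ℝ) T) (μ : P2 (CPath T H)) (ν : ProbabilityMeasure U) :
    Measurable fun p : CPath T H × U => c t p.1 μ p.2 ν := by
  let _ : MeasurableSpace (ProbabilityMeasure U) := borel _
  exact Measurable.comp hc (measurable_const.prodMk (measurable_fst.prodMk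
    (measurable_const.prodMk (measurable_snd.prodMk measurable_const))))

variable {T : ℝ} {H K : Type*}
  [NormedAddCommGroup H] [InnerProductSpace ℝ H] [MeasurableSpace H]
  [NormedAddCommGroup K] [InnerProductSpace ℝ K] [CompleteSpace K]
  {U : Type*} [TopologicalSpace U] [MeasurableSpace U] [OpensMeasurableSpace U]

variable {Ω : Type*} [MeasurableSpace Ω] {P : Measure Ω} [IsProbabilityMeasure P]
  {A : H →ₗ.[ℝ] H} {b : Coef T H U H} {σ : Coef T H U (HS K H)} {f : Coef T H U ℝ}
  {g : CPath T H → P2 (CPath T H) → ℝ}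
  {w : Icc (0 : ℝ) T → P2 (CPath T H) → ℝ} (W : C12bExtension P w)
  (t : Icc (0 : ℝ) T) (μ : P2 (CPath T H))

/-- Quadratic growth of `‖σ‖²`, uniformly in the control variables. The constant `L` of the
assumption is not required to be nonnegative, hence the absolute values. -/
theorem exists_bound_hs (hA : AssumptionAbσ A b σ) :
    ∃ C : ℝ, 0 ≤ C ∧ ∀ x (u : U) ν, Summable (fun i => ‖(σ t x μ u ν).1 (onb K i)‖ ^ 2) ∧
      ∑' i, ‖(σ t x μ u ν).1 (onb K i)‖ ^ 2 ≤ C * (1 + ‖x‖ ^ 2) := by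
  obtain ⟨L, -, hσ, hL⟩ := hA.lipschitz
  set M : ℝ := μ.W2 (P2.dirac 0) with hM
  have hM0 : 0 ≤ M := ENNReal.toReal_nonneg
  refine ⟨2 * |L| ^ 2 * (3 + 2 * M ^ 2), by positivity, fun x u ν => ?_⟩
  have h1 : hsNorm ((σ t x μ u ν).1 - (σ t 0 (P2.dirac 0) u ν).1) ≤
      ENNReal.ofReal (|L| * (‖x‖ + M)) := by
    refine (hσ t x μ 0 (P2.dirac 0) u ν).trans (ENNReal.ofReal_le_ofReal ?_)
    rw [sub_zero, ← hM]
    have h4 := CPath.norm_stoppedAt_le t x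
    gcongr
    exact le_abs_self L
  have h2 : hsNorm (σ t 0 (P2.dirac 0) u ν).1 ≤ ENNReal.ofReal |L| :=
    le_add_self.trans ((hL t u ν).trans (ENNReal.ofReal_le_ofReal (le_abs_self L)))
  obtain ⟨h3, h4⟩ := summable_and_tsum_le_of_hsNorm_sub_le (by positivity) (abs_nonneg L) h1 h2
  refine ⟨h3, h4.trans ?_⟩
  rw [mul_pow, mul_assoc, mul_assoc, ← mul_add_one]
  have : (‖x‖ + M) ^ 2 + 1 ≤ (3 + 2 * M ^ 2) * (1 + ‖x‖ ^ 2) := by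
    nlinarith [sq_nonneg (‖x‖ - M), mul_nonneg (sq_nonneg M) (sq_nonneg ‖x‖), sq_nonneg ‖x‖]
  gcongr

theorem exists_bound_firstOrder (hA : AssumptionAbσ A b σ) (hf : AssumptionFg f g) :
    ∃ C : ℝ, ∀ x (u : U) ν, |firstOrder b f W t μ x u ν| ≤ C * (1 + ‖x‖ ^ 2) := by
  obtain ⟨L, hb, -, hL⟩ := hA.lipschitz
  obtain ⟨h, -, hfb, -⟩ := hf.growth
  obtain ⟨D, hD0, hD⟩ := W.exists_bound t μ
  set M : ℝ := μ.W2 (P2.dirac 0) with hM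
  have hM0 : 0 ≤ M := ENNReal.toReal_nonneg
  set R : ℝ := ((h M.toNNReal : ℝ≥0) : ℝ) with hR
  have hR0 : 0 ≤ R := NNReal.coe_nonneg _
  refine ⟨R + (|L| * (2 + M)) * D, fun x u ν => ?_⟩
  have h1 : |f t x μ u ν| ≤ R * (1 + ‖x‖ ^ 2) :=
    (hfb t x μ u ν).trans (by gcongr; exact CPath.norm_stoppedAt_le t x)
  have h0 : ‖b t 0 (P2.dirac 0) u ν‖ ≤ |L| := by
    rw [← ENNReal.ofReal_le_ofReal_iff (abs_nonneg L)]
    exact le_self_add.trans ((hL t u ν).trans (ENNReal.ofReal_le_ofReal (le_abs_self L)))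
  have h2 : ‖b t x μ u ν‖ ≤ |L| * (2 + M) * (1 + ‖x‖ ^ 2) := by
    have h3 := hb t x μ 0 (P2.dirac 0) u ν
    rw [sub_zero, ← hM] at h3
    have h4 := CPath.norm_stoppedAt_le t x
    have h5 : L * (‖CPath.stoppedAt t x‖ + M) ≤ |L| * (‖x‖ + M) := by
      gcongr
      exact le_abs_self L
    have h6 := norm_le_norm_sub_add (b t x μ u ν) (b t 0 (P2.dirac 0) u ν)
    have h7 : |L| * (‖x‖ + M) + |L| ≤ |L| * (2 + M) * (1 + ‖x‖ ^ 2) := by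
      have : ‖x‖ + M + 1 ≤ (2 + M) * (1 + ‖x‖ ^ 2) := by
        nlinarith [sq_nonneg (‖x‖ - 1), mul_nonneg hM0 (sq_nonneg ‖x‖)]
      nlinarith [mul_le_mul_of_nonneg_left this (abs_nonneg L)]
    linarith
  have h8 : |⟪b t x μ u ν, W.dm t μ x⟫| ≤ |L| * (2 + M) * (1 + ‖x‖ ^ 2) * D :=
    (abs_real_inner_le_norm _ _).trans (mul_le_mul h2 (hD x).1 (norm_nonneg _) (by positivity))
  rw [firstOrder]
  refine (abs_add_le _ _).trans ?_
  linarith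

theorem measurable_firstOrder [TopologicalSpace.SeparableSpace H] [BorelSpace H]
    (hA : AssumptionAbσ A b σ) (hf : AssumptionFg f g)
    (ν : ProbabilityMeasure U) :
    Measurable fun p : CPath T H × U => firstOrder b f W t μ p.1 p.2 ν := by
  have := UniformSpace.secondCountable_of_separable H
  exact (hf.measurable_f.measurable_section t μ ν).add
    ((hA.measurable_b.measurable_section t μ ν).inner
      ((W.continuous_dm t μ).measurable.comp measurable_fst))

variable [CompleteSpace H]

theorem exists_bound_secondOrder (hA : AssumptionAbσ A b σ) :
    ∃ C : ℝ, ∀ x (u : U) ν, |secondOrder σ W t μ x u ν| ≤ C * (1 + ‖x‖ ^ 2) := by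
  obtain ⟨C, hC0, hC⟩ := exists_bound_hs (K := K) t μ hA
  obtain ⟨D, hD0, hD⟩ := W.exists_bound t μ
  refine ⟨D * C, fun x u ν => (abs_trace_le (hC x u ν).1 _).trans ?_⟩
  rw [mul_assoc]
  exact mul_le_mul (hD x).2 (hC x u ν).2 (tsum_nonneg fun _ => by positivity) hD0

theorem measurable_secondOrder [TopologicalSpace.SeparableSpace H] [BorelSpace H]
    [TopologicalSpace.SeparableSpace K] (hA : AssumptionAbσ A b σ)
    (ν : ProbabilityMeasure U) :
    Measurable fun p : CPath T H × U => secondOrder σ W t μ p.1 p.2 ν := by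
  have := UniformSpace.secondCountable_of_separable H
  have := countable_onbIndex K
  obtain ⟨C, -, hC⟩ := exists_bound_hs (K := K) t μ hA
  -- strong measurability, as the space of operators is not separable in the operator norm
  have hD : StronglyMeasurable fun p : CPath T H × U => W.dxm t μ p.1 :=
    (W.continuous_dxm t μ).stronglyMeasurable.comp_measurable measurable_fst
  have hterm : ∀ k, Measurable fun p : CPath T H × U =>
      ⟪W.dxm t μ p.1 ((σ t p.1 μ p.2 ν).1 (onb K k)), (σ t p.1 μ p.2 ν).1 (onb K k)⟫ := by
    intro k
    have hs : Measurable fun p : CPath T H × U => (σ t p.1 μ p.2 ν).1 (onb K k) :=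
      (HS.measurable_apply_onb k).comp (hA.measurable_σ.measurable_section t μ ν)
    have hDs : StronglyMeasurable fun p : CPath T H × U =>
        W.dxm t μ p.1 ((σ t p.1 μ p.2 ν).1 (onb K k)) :=
      (isBoundedBilinearMap_apply (𝕜 := ℝ) (E := H) (F := H)).continuous.comp_stronglyMeasurable
        (hD.prodMk hs.stronglyMeasurable)
    exact hDs.measurable.inner hs
  refine measurable_of_tendsto_metrizable' (u := (atTop : Filter (Finset (OnbIndex K))))
    (f := fun s p => ∑ k ∈ s,
      ⟪W.dxm t μ p.1 ((σ t p.1 μ p.2 ν).1 (onb K k)), (σ t p.1 μ p.2 ν).1 (onb K k)⟫)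
    (fun s => Finset.measurable_fun_sum s fun k _ => hterm k) ?_
  exact tendsto_pi_nhds.2 fun p => hasSum_trace (hC p.1 p.2 ν).1 (W.dxm t μ p.1)

end Hamiltonian

/-! ### Randomized feedbacks and joint laws -/

/-- A random variable `V` that is uniform on `[0,1]` and independent of `ξ` allows one to
reproduce the joint law of `ξ` with any `a`: a Borel map represents the conditional law of `a`
given `ξ` as an image of the uniform law. -/
theorem exists_randomized_map_eq {Ω X Y : Type*} [MeasurableSpace Ω] {P : Measure Ω}
    [IsProbabilityMeasure P] [MeasurableSpace X] [MeasurableSpace Y] [StandardBorelSpace Y]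
    [Nonempty Y] {ξ : Ω → X} {a : Ω → Y} {V : Ω → Icc (0 : ℝ) 1} (hξ : Measurable ξ)
    (ha : Measurable a) (hV : Measurable V) (hVu : P.map V = volume) (hind : IndepFun ξ V P) :
    ∃ c : X × Icc (0 : ℝ) 1 → Y, Measurable c ∧
      P.map (fun ω => (ξ ω, c (ξ ω, V ω))) = P.map (fun ω => (ξ ω, a ω)) := by
  obtain ⟨c, hc, hcκ⟩ := Kernel.exists_measurable_map_eq_unitInterval (condDistrib a ξ P)
  refine ⟨Function.uncurry c, hc, ?_⟩
  have := Measure.isProbabilityMeasure_map (μ := P) hξ.aemeasurable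
  have hpair : P.map (fun ω => (ξ ω, V ω)) = (P.map ξ).prod volume := by
    rw [← hVu]
    exact (indepFun_iff_map_prod_eq_prod_map_map hξ.aemeasurable hV.aemeasurable).1 hind
  have hm : Measurable fun p : X × Icc (0 : ℝ) 1 => (p.1, Function.uncurry c p) :=
    measurable_fst.prodMk hc
  rw [← compProd_map_condDistrib ha.aemeasurable,
    show (fun ω => (ξ ω, Function.uncurry c (ξ ω, V ω))) =
      (fun p : X × Icc (0 : ℝ) 1 => (p.1, Function.uncurry c p)) ∘ fun ω => (ξ ω, V ω) from rfl,
    ← Measure.map_map hm (hξ.prodMk hV), hpair]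
  ext s hs
  rw [Measure.map_apply hm hs, Measure.prod_apply (hm hs), Measure.compProd_apply hs]
  refine lintegral_congr fun x => ?_
  rw [← hcκ x, Measure.map_apply hc.of_uncurry_left (measurable_prodMk_left hs)]
  rfl

/-! ### Pathwise suprema -/

/-- The pathwise supremum of a Borel function agrees almost everywhere with a Borel function, which
is the pointwise limit of the values along a sequence of Borel selectors. -/
theorem exists_seq_measurable_selectors {X Y : Type*} [TopologicalSpace X] [PolishSpace X]
    [MeasurableSpace X] [BorelSpace X] [MeasurableSpace Y] [StandardBorelSpace Y] [Nonempty Y]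
    (m : Measure X) [IsFiniteMeasure m] {Φ : X → Y → ℝ}
    (hΦ : Measurable fun p : X × Y => Φ p.1 p.2) (hbdd : ∀ x, BddAbove (range (Φ x))) :
    ∃ (Z : X → ℝ) (a : ℕ → X → Y), Measurable Z ∧ (∀ n, Measurable (a n)) ∧
      (∀ᵐ x ∂m, ∀ y, Φ x y ≤ Z x) ∧ ∀ x, Tendsto (fun n => Φ x (a n x)) atTop (𝓝 (Z x)) := by
  classical
  obtain ⟨q, hq⟩ := exists_surjective_nat ℚ
  choose s hs hsel using fun k => exists_measurable_selection m
    (measurableSet_lt (measurable_const (a := (q k : ℝ))) hΦ)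
  -- `a n` maximizes the value among the first `n + 1` selectors
  let a : ℕ → X → Y := fun n => Nat.rec (s 0)
    (fun n a x => if Φ x (a x) ≤ Φ x (s (n + 1) x) then s (n + 1) x else a x) n
  have hsucc : ∀ n x, a (n + 1) x =
      if Φ x (a n x) ≤ Φ x (s (n + 1) x) then s (n + 1) x else a n x := fun n x => rfl
  have hcomp : ∀ {c : X → Y}, Measurable c → Measurable fun x => Φ x (c x) :=
    fun hc => hΦ.comp (measurable_id.prodMk hc)
  have ha : ∀ n, Measurable (a n) := by
    intro n
    induction n with
    | zero => exact hs 0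
    | succ n ih => exact Measurable.ite (measurableSet_le (hcomp ih) (hcomp (hs _))) (hs _) ih
  have hstep : ∀ n x, Φ x (a (n + 1) x) = max (Φ x (a n x)) (Φ x (s (n + 1) x)) := by
    intro n x
    rw [hsucc]
    split_ifs with h
    · exact (max_eq_right h).symm
    · exact (max_eq_left (le_of_not_ge h)).symm
  have hmono : ∀ x, Monotone fun n => Φ x (a n x) := fun x =>
    monotone_nat_of_le_succ fun n => by rw [hstep]; exact le_max_left _ _
  have hge : ∀ n x, Φ x (s n x) ≤ Φ x (a n x) := by
    rintro (_ | n) x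
    · exact le_rfl
    · rw [hstep]; exact le_max_right _ _
  have hbdd' : ∀ x, BddAbove (range fun n => Φ x (a n x)) := fun x =>
    (hbdd x).mono (range_subset_iff.2 fun n => mem_range_self _)
  have hlim : ∀ x, Tendsto (fun n => Φ x (a n x)) atTop (𝓝 (⨆ n, Φ x (a n x))) := fun x =>
    tendsto_atTop_ciSup (hmono x) (hbdd' x)
  refine ⟨fun x => ⨆ n, Φ x (a n x), a, ?_, ha, ?_, hlim⟩
  · exact measurable_of_tendsto_metrizable (fun n => hcomp (ha n)) (tendsto_pi_nhds.2 hlim)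
  · filter_upwards [ae_all_iff.2 hsel] with x hx y
    refine le_of_forall_rat_lt_imp_le fun r hr => ?_
    obtain ⟨k, rfl⟩ := hq r
    have h1 : (q k : ℝ) < Φ x (s k x) := hx k ⟨y, hr⟩
    exact h1.le.trans ((hge k x).trans (le_ciSup (hbdd' x) k))

/-! ### Suprema over sets of controls -/

section Controls

variable {Ω : Type*} [MeasurableSpace Ω] {P : Measure Ω} [IsProbabilityMeasure P]
  {T : ℝ} {H : Type*} [NormedAddCommGroup H]
  {U : Type*} [MeasurableSpace U]
  {ξ : Ω → CPath T H}

theorem IsS2.measurable_path {Ω : Type*} {m mΩ : MeasurableSpace Ω} {P : Measure Ω}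
    [TopologicalSpace.SeparableSpace H] [MeasurableSpace H] [BorelSpace H] {ξ : Ω → CPath T H}
    (hξ : IsS2 m P ξ) : Measurable[m] ξ :=
  @CPath.measurable_of_eval _ _ _ _ _ _ _ m _ fun s =>
    hξ.measurable.comp (@measurable_prodMk_left _ _ _ m s)

/-- Randomized feedbacks attain every value of the expectation, so adding further controls does not
increase the supremum. -/
theorem supOver_eq_randomizedFeedbacks [StandardBorelSpace U] [Nonempty U]
    {Φ : CPath T H → U → ProbabilityMeasure U → ℝ}
    (hΦ : ∀ ν, Measurable fun p : CPath T H × U => Φ p.1 p.2 ν) (hξ : Measurable ξ)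
    {V : Ω → Icc (0 : ℝ) 1} (hV : Measurable V) (hVu : P.map V = volume)
    (hind : IndepFun ξ V P) {M : Set (RandomControl Ω U)} (hM : randomizedFeedbacks ξ V ⊆ M) :
    supOver P ξ Φ M = supOver P ξ Φ (randomizedFeedbacks ξ V) := by
  refine le_antisymm (iSup₂_le fun a _ => ?_) (biSup_mono hM)
  obtain ⟨c, hc, hmap⟩ := exists_randomized_map_eq hξ a.2 hV hVu hind
  let a' : RandomControl Ω U := ⟨fun ω => c (ξ ω, V ω), hc.comp (hξ.prodMk hV)⟩
  have hlaw : a'.law P = a.law P := by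
    have h := congrArg (Measure.map Prod.snd) hmap
    rw [Measure.map_map measurable_snd (hξ.prodMk a'.2),
      Measure.map_map measurable_snd (hξ.prodMk a.2)] at h
    exact Subtype.ext h
  have hint : ∫ ω, Φ (ξ ω) (a.1 ω) (a.law P) ∂P = ∫ ω, Φ (ξ ω) (a'.1 ω) (a'.law P) ∂P := by
    rw [hlaw]
    have h1 := integral_map (μ := P) (hξ.prodMk a.2).aemeasurable
      (hΦ (a.law P)).aestronglyMeasurable
    have h2 := integral_map (μ := P) (hξ.prodMk a'.2).aemeasurable
      (hΦ (a.law P)).aestronglyMeasurable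
    rw [← h1, ← h2]
    exact congrArg (fun m => ∫ p, Φ p.1 p.2 (a.law P) ∂m) hmap.symm
  rw [hint]
  exact le_iSup₂_of_le a' ⟨c, hc, fun _ => rfl⟩ le_rfl

theorem feedbacks_subset {Ω : Type*} {m mΩ : MeasurableSpace Ω} {ξ : Ω → CPath T H}
    (hξ : Measurable[m] ξ) :
    feedbacks (U := U) ξ ⊆ measurableControls m := by
  rintro a ⟨c, hc, hac⟩
  have h : Measurable[m] (c ∘ ξ) := hc.comp hξ
  rwa [← show a.1 = c ∘ ξ from funext hac] at h

theorem randomizedFeedbacks_subset {Ω : Type*} {m mΩ : MeasurableSpace Ω} {ξ : Ω → CPath T H}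
    (hξ : Measurable[m] ξ)
    {V : Ω → Icc (0 : ℝ) 1} (hV : Measurable[m] V) :
    randomizedFeedbacks (U := U) ξ V ⊆ measurableControls m := by
  rintro a ⟨c, hc, hac⟩
  have h : Measurable[m] fun ω => c (ξ ω, V ω) := hc.comp (hξ.prodMk hV)
  rwa [← show a.1 = fun ω => c (ξ ω, V ω) from funext hac] at h

theorem IsEssSup.ae_eq {Ω ι : Type*} [MeasurableSpace Ω] {P : Measure Ω}
    {X : ι → Ω → ℝ} {Z Z' : Ω → ℝ} (h : IsEssSup P X Z)
    (h' : IsEssSup P X Z') : Z =ᵐ[P] Z' := by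
  filter_upwards [h.least Z' h'.measurable h'.le_ae, h'.least Z h.measurable h.le_ae] with ω h1 h2
  exact le_antisymm h1 h2

/-- For a function without mean-field dependence on the control, the supremum over any set of
controls that contains the feedbacks is the expectation of the essential supremum. -/
theorem exists_isEssSup_supOver_eq [TopologicalSpace.SeparableSpace H] [CompleteSpace H]
    [StandardBorelSpace U] [Nonempty U] {Φ : CPath T H → U → ℝ}
    (hΦ : Measurable fun p : CPath T H × U => Φ p.1 p.2) (hξ : Measurable ξ)
    {C : ℝ} (hC : ∀ x u, |Φ x u| ≤ C * (1 + ‖x‖ ^ 2))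
    (hint : Integrable (fun ω => C * (1 + ‖ξ ω‖ ^ 2)) P)
    {M : Set (RandomControl Ω U)} (hM : feedbacks ξ ⊆ M) :
    ∃ Z, IsEssSup P (fun u ω => Φ (ξ ω) u) Z ∧ Integrable Z P ∧
      supOver P ξ (fun x u _ => Φ x u) M = ((∫ ω, Z ω ∂P : ℝ) : EReal) := by
  have := UniformSpace.secondCountable_of_separable H
  have := Measure.isProbabilityMeasure_map (μ := P) hξ.aemeasurable
  obtain ⟨Z, a, hZ, ha, hle, hlim⟩ := exists_seq_measurable_selectors (P.map ξ) hΦ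
    fun x => ⟨C * (1 + ‖x‖ ^ 2), by rintro _ ⟨u, rfl⟩; exact (le_abs_self _).trans (hC x u)⟩
  have hle' : ∀ᵐ ω ∂P, ∀ u, Φ (ξ ω) u ≤ Z (ξ ω) := ae_of_ae_map hξ.aemeasurable hle
  have hmeas : ∀ {c : Ω → U}, Measurable c → AEStronglyMeasurable (fun ω => Φ (ξ ω) (c ω)) P :=
    fun hc => (hΦ.comp (hξ.prodMk hc)).aestronglyMeasurable
  have hZint : Integrable (fun ω => Z (ξ ω)) P := by
    refine hint.mono' (hZ.comp hξ).aestronglyMeasurable (Eventually.of_forall fun ω => ?_)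
    exact le_of_tendsto' (hlim (ξ ω)).norm fun n => hC _ _
  refine ⟨fun ω => Z (ξ ω), ⟨hZ.comp hξ, hle', fun Z' _ h => ?_⟩, hZint, le_antisymm ?_ ?_⟩
  · filter_upwards [h] with ω hω
    exact le_of_tendsto' (hlim (ξ ω)) fun n => hω _
  · refine iSup₂_le fun c _ => EReal.coe_le_coe_iff.2 (integral_mono_ae ?_ hZint ?_)
    · exact hint.mono' (hmeas c.2) (Eventually.of_forall fun ω => hC _ _)
    · filter_upwards [hle'] with ω hω using hω _
  · have hconv : Tendsto (fun n => ∫ ω, Φ (ξ ω) (a n (ξ ω)) ∂P) atTop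
        (𝓝 (∫ ω, Z (ξ ω) ∂P)) :=
      tendsto_integral_of_dominated_convergence _ (fun n => hmeas ((ha n).comp hξ)) hint
        (fun n => Eventually.of_forall fun ω => hC _ _) (Eventually.of_forall fun ω => hlim (ξ ω))
    refine le_of_tendsto' ((continuous_coe_real_ereal.tendsto _).comp hconv) fun n => ?_
    let c : RandomControl Ω U := ⟨fun ω => a n (ξ ω), (ha n).comp hξ⟩
    exact le_iSup₂_of_le (f := fun (c : RandomControl Ω U) (_ : c ∈ M) =>
      ((∫ ω, Φ (ξ ω) (c.1 ω) ∂P : ℝ) : EReal)) c (hM ⟨a n, ha n, fun _ => rfl⟩) le_rfl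

end Controls

end MasterBellman

/-! ### Equivalence of the formulations -/

theorem proposition5p7
    {H K E Ω : Type*}
    [NormedAddCommGroup H] [InnerProductSpace ℝ H] [CompleteSpace H]
    [TopologicalSpace.SeparableSpace H] [MeasurableSpace H] [BorelSpace H]
    [NormedAddCommGroup K] [InnerProductSpace ℝ K] [CompleteSpace K]
    [TopologicalSpace.SeparableSpace K]
    -- the space of control actions, a nonempty Borel subset of a Polish space
    [TopologicalSpace E] [PolishSpace E] [MeasurableSpace E] [BorelSpace E]
    (U : Set E) (hU : MeasurableSet U) (hU' : U.Nonempty)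
    -- the complete probability space, the cylindrical Brownian motion and the σ-algebra 𝒢
    (G : MeasurableSpace Ω) [MeasurableSpace Ω] (P : Measure Ω) [IsProbabilityMeasure P]
    [P.IsComplete] (T : ℝ) (hT : 0 < T) (B : ℝ≥0 → K → Ω → ℝ) (hS : IsSetting G P T H B)
    -- the coefficients
    (A : H →ₗ.[ℝ] H) (b : Coef T H U H) (σ : Coef T H U (HS K H)) (f : Coef T H U ℝ)
    (g : CPath T H → P2 (CPath T H) → ℝ)
    (hAbσ : AssumptionAbσ A b σ) (hfg : AssumptionFg f g)
    -- the point (t, μ), the function w ∈ 𝑪_b^{1,2} and the process ξ ∈ 𝐒₂(𝒢) with law μ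
    (t : Icc (0 : ℝ) T) (μ : P2 (CPath T H))
    (w : Icc (0 : ℝ) T → P2 (CPath T H) → ℝ) (W : C12bExtension P w)
    (ξ : Ω → CPath T H) (hξ : IsS2 G P ξ) (hξμ : P.map ξ = μ.toMeasure) :
    -- all the expectations are well defined
    (∀ a ∈ measurableControls (U := U) (filtration G P B t),
      Integrable (fun ω => hamF b σ f W t μ (ξ ω) (a.1 ω) (a.law P)) P) ∧
    -- first part
    (∀ Uξ : Ω → Icc (0 : ℝ) 1, Measurable[G] Uξ → P.map Uξ = volume → IndepFun ξ Uξ P →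
      supOver P ξ (hamF b σ f W t μ) (measurableControls (filtration G P B t)) =
        supOver P ξ (hamF b σ f W t μ) (measurableControls G) ∧
      supOver P ξ (hamF b σ f W t μ) (measurableControls G) =
        supOver P ξ (hamF b σ f W t μ) (randomizedFeedbacks ξ Uξ) ∧
      ((t : ℝ) < T → InAdjointDomain W t μ ξ A →
        (BellmanEq W t μ ξ A
            (hamiltonian b σ f W t μ ξ (measurableControls (filtration G P B t))) ↔
          BellmanEq W t μ ξ A (hamiltonian b σ f W t μ ξ (measurableControls G))) ∧
        (BellmanEq W t μ ξ A
            (hamiltonian b σ f W t μ ξ (measurableControls (filtration G P B t))) ↔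
          BellmanEq W t μ ξ A (hamiltonian b σ f W t μ ξ (randomizedFeedbacks ξ Uξ))))) ∧
    -- second part
    (∀ F₀ : CPath T H → U → ℝ, (∀ x u ν, hamF b σ f W t μ x u ν = F₀ x u) →
      supOver P ξ (fun x u _ => F₀ x u) (measurableControls (filtration G P B t)) =
        supOver P ξ (fun x u _ => F₀ x u) (feedbacks ξ) ∧
      (∃ Z, IsEssSup P (fun u ω => F₀ (ξ ω) u) Z) ∧
      (∀ Z, IsEssSup P (fun u ω => F₀ (ξ ω) u) Z → Integrable Z P ∧
        supOver P ξ (fun x u _ => F₀ x u) (feedbacks ξ) = ((∫ ω, Z ω ∂P : ℝ) : EReal)) ∧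
      ((t : ℝ) < T → InAdjointDomain W t μ ξ A →
        (BellmanEq W t μ ξ A
            (hamiltonian b σ f W t μ ξ (measurableControls (filtration G P B t))) ↔
          BellmanEq W t μ ξ A (hamiltonian b σ f W t μ ξ (feedbacks ξ))) ∧
        ∀ Z, IsEssSup P (fun u ω => F₀ (ξ ω) u) Z →
          (BellmanEq W t μ ξ A
              (hamiltonian b σ f W t μ ξ (measurableControls (filtration G P B t))) ↔
            BellmanEq W t μ ξ A ((∫ ω, Z ω ∂P : ℝ) : EReal)))) := by
  have hUs : StandardBorelSpace U := hU.standardBorel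
  have : Nonempty U := hU'.to_subtype
  have hξG : Measurable[G] ξ := hξ.measurable_path
  have hξm : Measurable ξ := hξG.mono hS.le le_rfl
  obtain ⟨C₁, hC₁⟩ := exists_bound_firstOrder (K := K) W t μ hAbσ hfg
  obtain ⟨C₂, hC₂⟩ := exists_bound_secondOrder (K := K) W t μ hAbσ
  have hm₁ := measurable_firstOrder W t μ hAbσ hfg
  have hm₂ := measurable_secondOrder W t μ hAbσ
  have hmF : ∀ ν, Measurable fun p : CPath T H × U => hamF b σ f W t μ p.1 p.2 ν :=
    fun ν => (hm₁ ν).add ((hm₂ ν).const_mul _)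
  have hsq : ∀ C : ℝ, Integrable (fun ω => C * (1 + ‖ξ ω‖ ^ 2)) P := by
    intro C
    have h : MemLp (fun ω => ‖ξ ω‖) 2 P := by
      refine ⟨hξm.norm.aestronglyMeasurable, ?_⟩
      rw [eLpNorm_lt_top_iff_lintegral_rpow_enorm_lt_top two_ne_zero ENNReal.ofNat_ne_top]
      simpa using hξ.moment
    exact ((integrable_const 1).add h.integrable_sq).const_mul C
  have hi₁ : ∀ a : RandomControl Ω U,
      Integrable (fun ω => firstOrder b f W t μ (ξ ω) (a.1 ω) (a.law P)) P := fun a =>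
    (hsq C₁).mono' ((hm₁ _).comp (hξm.prodMk a.2)).aestronglyMeasurable
      (Eventually.of_forall fun ω => hC₁ _ _ _)
  have hi₂ : ∀ a : RandomControl Ω U,
      Integrable (fun ω => secondOrder σ W t μ (ξ ω) (a.1 ω) (a.law P)) P := fun a =>
    (hsq C₂).mono' ((hm₂ _).comp (hξm.prodMk a.2)).aestronglyMeasurable
      (Eventually.of_forall fun ω => hC₂ _ _ _)
  have hiF : ∀ a : RandomControl Ω U,
      Integrable (fun ω => hamF b σ f W t μ (ξ ω) (a.1 ω) (a.law P)) P := fun a =>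
    (hi₁ a).add ((hi₂ a).const_mul _)
  have hham : ∀ M : Set (RandomControl Ω U),
      hamiltonian b σ f W t μ ξ M = supOver P ξ (hamF b σ f W t μ) M := by
    intro M
    refine iSup_congr fun a => iSup_congr fun _ => congrArg _ ?_
    rw [← integral_const_mul, ← integral_add (hi₁ a) ((hi₂ a).const_mul _)]
    rfl
  have hGF : G ≤ filtration G P B t := le_sup_left
  refine ⟨fun a _ => hiF a, fun V hV hVu hind => ?_, fun F₀ hF₀ => ?_⟩
  · have hG := supOver_eq_randomizedFeedbacks hmF hξm (hV.mono hS.le le_rfl) hVu hind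
      (randomizedFeedbacks_subset hξG hV)
    have hF := supOver_eq_randomizedFeedbacks hmF hξm (hV.mono hS.le le_rfl) hVu hind
      (randomizedFeedbacks_subset (hξG.mono hGF le_rfl) (hV.mono hGF le_rfl))
    refine ⟨hF.trans hG.symm, hG, fun _ _ => ?_⟩
    simp only [hham, hF, hG, and_self]
  · have hFeq : hamF b σ f W t μ = fun x u _ => F₀ x u := by
      funext x u ν
      exact hF₀ x u ν
    obtain ⟨u₀⟩ := ‹Nonempty U›
    -- any law serves to recover the properties of `F₀` from those of `hamF`
    let ν₀ : ProbabilityMeasure U := ⟨Measure.dirac u₀, inferInstance⟩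
    have hm : Measurable fun p : CPath T H × U => F₀ p.1 p.2 := by
      simpa only [hFeq] using hmF ν₀
    have hC : ∀ x u, |F₀ x u| ≤ (C₁ + 1 / 2 * C₂) * (1 + ‖x‖ ^ 2) := by
      intro x u
      rw [← hF₀ x u ν₀, hamF]
      refine (abs_add_le _ _).trans ?_
      rw [abs_mul, abs_of_pos (by norm_num : (0 : ℝ) < 1 / 2)]
      linarith [hC₁ x u ν₀, hC₂ x u ν₀]
    have : Nonempty U := ⟨u₀⟩
    obtain ⟨Z, hZ, hZi, hZs⟩ := exists_isEssSup_supOver_eq hm hξm hC (hsq _) subset_rfl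
    obtain ⟨Z', hZ', -, hZs'⟩ := exists_isEssSup_supOver_eq hm hξm hC (hsq _)
      (feedbacks_subset (hξG.mono hGF le_rfl))
    have hF : supOver P ξ (fun x u _ => F₀ x u) (measurableControls (filtration G P B t)) =
        supOver P ξ (fun x u _ => F₀ x u) (feedbacks ξ) := by
      rw [hZs, hZs', integral_congr_ae (hZ'.ae_eq hZ)]
    have hZs_any : ∀ Y, IsEssSup P (fun u ω => F₀ (ξ ω) u) Y →
        supOver P ξ (fun x u _ => F₀ x u) (feedbacks ξ) = ((∫ ω, Y ω ∂P : ℝ) : EReal) :=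
      fun Y hY => by rw [hZs, integral_congr_ae (hZ.ae_eq hY)]
    refine ⟨hF, ⟨Z, hZ⟩, fun Y hY => ⟨hZi.congr (hZ.ae_eq hY), hZs_any Y hY⟩, fun _ _ => ⟨?_, ?_⟩⟩
    · rw [hham, hham, hFeq, hF]
    · intro Y hY
      rw [hham, hFeq, hF, hZs_any Y hY]
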